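/- Let $(M,g)$ be a smooth Riemannian manifold without boundary (Hausdorff, second countable, not necessarily compact), and let $\mathcal E\to M$ be a smooth real vector bundle of finite rank with a smooth fibre metric $\langle\,,\rangle$ and a smooth connection $\nabla$ compatible with $\langle\,,\rangle$. For $p,q\in\mathbb R$ the vertical $(p,q)$-energy of a smooth section $\sigma$ of $\mathcal E$ over a compact set $K\subseteq M$ is $$E^v_{p,q}(\sigma;K)=\frac12\int_K\frac{1}{(1+|\sigma|^2)^{p}}\sum_i\Bigl(|\nabla_{E_i}\sigma|^2+q\,\langle\nabla_{E_i}\sigma,\sigma\rangle^2\Bigr)\,\mathrm{vol}(g),$$ where $\{E_i\}$ denotes, at each point, an orthonormal basis of the tangent space of $M$. The section $\sigma$ is called $(p,q)$-harmonic if $\frac{d}{dt}\big|_{t=0}E^v_{p,q}(\sigma_t;K)=0$ for every compact $K\subseteq M$ and every smooth variation $\sigma_t$ ($t\in\mathbb R$) of $\sigma_0=\sigma$ through sections of $\mathcal E$ with $\sigma_t=\sigma$ outside $K$ for all $t$. It is called parallel if $\nabla\sigma=0$. For $r\in\mathbb R$, a smooth section $\sigma$ is called $r$-Riemannian if $r|\sigma(x)|^2\ge-1$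 for all $x\in M$, and strictly $r$-Riemannian if in addition $r|\sigma(x)|^2>-1$ for some $x\in M$. **Theorem 4.5.** Let $p,q,\nu\in\mathbb R$ with $(p,q)\in\mathcal G_1(\nu)=\{(p,q):p>1,\ q\ge2\nu(1-p)\}$, and let $\sigma$ be a section of $\mathcal E$ such that either (a) $\nu>1$ and $\sigma$ is $\nu(1-p)$-Riemannian; or (b) $\nu=1$, $\sigma$ is strictly $(1-p)$-Riemannian, and $M$ is connected. Suppose also that $|\sigma|^2$ is a harmonic function on $(M,g)$, that is, its Laplace–Beltrami Laplacian vanishes. Then $\sigma$ is a $(p,q)$-harmonic section of $\mathcal E$ if and only if $\sigma$ is parallel. -/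

import Mathlib

open MeasureTheory Bundle
open scoped Manifold ContDiff

noncomputable section

/-! ### Riemannian volume and harmonic functions -/

section Manifold

variable {n : ℕ} {M : Type*} [TopologicalSpace M] [ChartedSpace (EuclideanSpace ℝ (Fin n)) M]
  [RiemannianBundle (fun x : M ↦ TangentSpace (𝓡 n) x)]

/-- The coordinate vector field `∂_i` of the chart around `x₀`, at the point with coordinates `y`
(in the chart). -/
def coordVector (x₀ : M) (i : Fin n) (y : EuclideanSpace ℝ (Fin n)) :
    TangentSpace (𝓡 n) ((extChartAt (𝓡 n) x₀).symm y) :=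
  mfderiv (𝓡 n) (𝓡 n) (extChartAt (𝓡 n) x₀).symm y (EuclideanSpace.single i (1 : ℝ))

/-- The matrix `g_{ij} = g(∂_i, ∂_j)` of the metric in the chart around `x₀`. -/
def gramMatrix (x₀ : M) (y : EuclideanSpace ℝ (Fin n)) : Matrix (Fin n) (Fin n) ℝ :=
  Matrix.of fun i j ↦ inner ℝ (coordVector x₀ i y) (coordVector x₀ j y)

/-- The density `√(det g_{ij})` of the Riemannian volume in the chart around `x₀`. -/
def volumeDensity (x₀ : M) (y : EuclideanSpace ℝ (Fin n)) : ℝ :=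
  √(gramMatrix x₀ y).det

/-- The Riemannian volume of the domain of the chart around `x₀`, as a measure on `M` which gives
no mass to the complement of this domain: `√(det g_{ij}) dy` transported by the chart. -/
def chartVolume (n : ℕ) {M : Type*} [TopologicalSpace M]
    [ChartedSpace (EuclideanSpace ℝ (Fin n)) M]
    [RiemannianBundle (fun x : M ↦ TangentSpace (𝓡 n) x)] [MeasurableSpace M] (x₀ : M) :
    Measure M :=
  Measure.map (extChartAt (𝓡 n) x₀).symm
    ((volume.restrict (extChartAt (𝓡 n) x₀).target).withDensity
      fun y ↦ ENNReal.ofReal (volumeDensity x₀ y))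

/-- The Riemannian volume measure `vol(g)`. By the change of variables formula the measures
`chartVolume n x₀` agree on the overlaps of the chart domains, and `vol(g)` is the least measure
which dominates all of them, that is, the measure which restricts to each of them on the
corresponding chart domain. -/
def riemannianVolume (n : ℕ) (M : Type*) [TopologicalSpace M]
    [ChartedSpace (EuclideanSpace ℝ (Fin n)) M]
    [RiemannianBundle (fun x : M ↦ TangentSpace (𝓡 n) x)] [MeasurableSpace M] : Measure M :=
  ⨆ x₀ : M, chartVolume n x₀

/-- The Laplace-Beltrami operator `(det g)^{-1/2} ∑ i, ∂_i ((det g)^{1/2} ∑ j, g^{ij} ∂_j f)` in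
the chart around `x₀`, at the point with coordinates `y`. -/
def laplaceBeltramiInChart (x₀ : M) (f : M → ℝ) (y : EuclideanSpace ℝ (Fin n)) : ℝ :=
  (volumeDensity x₀ y)⁻¹ * ∑ i : Fin n,
    fderiv ℝ (fun z : EuclideanSpace ℝ (Fin n) ↦ volumeDensity x₀ z * ∑ j : Fin n,
      (gramMatrix x₀ z)⁻¹ i j *
        fderiv ℝ (f ∘ (extChartAt (𝓡 n) x₀).symm) z (EuclideanSpace.single j (1 : ℝ)))
      y (EuclideanSpace.single i (1 : ℝ))

/-- A function on a Riemannian manifold is harmonic if it is `C²` and its Laplacian vanishes.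
(The Laplacian does not depend on the chart, so "in every chart" is the same as "at every
point, in some chart".) -/
def IsHarmonicFunction (n : ℕ) {M : Type*} [TopologicalSpace M]
    [ChartedSpace (EuclideanSpace ℝ (Fin n)) M]
    [RiemannianBundle (fun x : M ↦ TangentSpace (𝓡 n) x)] (f : M → ℝ) : Prop :=
  ContMDiff (𝓡 n) 𝓘(ℝ, ℝ) 2 f ∧
    ∀ x₀ : M, ∀ y ∈ (extChartAt (𝓡 n) x₀).target, laplaceBeltramiInChart x₀ f y = 0

end Manifold

/-! ### Sections of a Riemannian vector bundle -/

/-- The restriction of `h_{p,q}` to the vertical space at a point `e` of the bundle, which is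
identified with the fibre through `e`:
`h_{p,q}(A, B) = w(e)^p (⟨A, B⟩ + q ⟨A, e⟩ ⟨B, e⟩)` with `w(e) = 1 / (1 + |e|²)`. -/
def verticalMetric {W : Type*} [NormedAddCommGroup W] [InnerProductSpace ℝ W] (p q : ℝ)
    (e A B : W) : ℝ :=
  (1 / (1 + ‖e‖ ^ 2)) ^ p * (inner ℝ A B + q * inner ℝ A e * inner ℝ B e)

section Sections

variable {n : ℕ} {M : Type*} [TopologicalSpace M] [ChartedSpace (EuclideanSpace ℝ (Fin n)) M]
  {F : Type*} [NormedAddCommGroup F] [NormedSpace ℝ F]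
  {V : M → Type*} [TopologicalSpace (TotalSpace F V)]
  [∀ x, NormedAddCommGroup (V x)] [∀ x, InnerProductSpace ℝ (V x)] [FiberBundle F V]

/-- Smooth sections. -/
def IsSmoothSection (n : ℕ) {M : Type*} [TopologicalSpace M]
    [ChartedSpace (EuclideanSpace ℝ (Fin n)) M]
    (F : Type*) [NormedAddCommGroup F] [NormedSpace ℝ F]
    {V : M → Type*} [TopologicalSpace (TotalSpace F V)]
    [∀ x, NormedAddCommGroup (V x)] [FiberBundle F V] (σ : Π x : M, V x) : Prop :=
  ContMDiff (𝓡 n) ((𝓡 n).prod 𝓘(ℝ, F)) ∞ (fun x : M ↦ (⟨x, σ x⟩ : TotalSpace F V))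

/-- `q`-Riemannian sections. -/
def IsQRiemannian (n : ℕ) {M : Type*} [TopologicalSpace M]
    [ChartedSpace (EuclideanSpace ℝ (Fin n)) M]
    (F : Type*) [NormedAddCommGroup F] [NormedSpace ℝ F]
    {V : M → Type*} [TopologicalSpace (TotalSpace F V)]
    [∀ x, NormedAddCommGroup (V x)] [FiberBundle F V] (q : ℝ) (σ : Π x : M, V x) : Prop :=
  IsSmoothSection n F σ ∧ ∀ x : M, -1 ≤ q * ‖σ x‖ ^ 2

/-- Strictly `q`-Riemannian sections. -/
def IsStrictlyQRiemannian (n : ℕ) {M : Type*} [TopologicalSpace M]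
    [ChartedSpace (EuclideanSpace ℝ (Fin n)) M]
    (F : Type*) [NormedAddCommGroup F] [NormedSpace ℝ F]
    {V : M → Type*} [TopologicalSpace (TotalSpace F V)]
    [∀ x, NormedAddCommGroup (V x)] [FiberBundle F V] (q : ℝ) (σ : Π x : M, V x) : Prop :=
  IsQRiemannian n F q σ ∧ ∃ x : M, -1 < q * ‖σ x‖ ^ 2

/-- Parallel sections: `∇σ = 0`. -/
def IsParallelSection (cov : CovariantDerivative (𝓡 n) F V) (σ : Π x : M, V x) : Prop :=
  ∀ x : M, cov σ x = 0

/-- A smooth variation `(x, t) ↦ σ_t(x)` of `σ = σ_0` through sections. -/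
structure IsSmoothVariation (n : ℕ) {M : Type*} [TopologicalSpace M]
    [ChartedSpace (EuclideanSpace ℝ (Fin n)) M]
    (F : Type*) [NormedAddCommGroup F] [NormedSpace ℝ F]
    {V : M → Type*} [TopologicalSpace (TotalSpace F V)]
    [∀ x, NormedAddCommGroup (V x)] [FiberBundle F V]
    (σ : Π x : M, V x) (s : ℝ → Π x : M, V x) : Prop where
  contMDiff : ContMDiff ((𝓡 n).prod 𝓘(ℝ, ℝ)) ((𝓡 n).prod 𝓘(ℝ, F)) ∞
    (fun z : M × ℝ ↦ (⟨z.1, s z.2 z.1⟩ : TotalSpace F V))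
  zero : s 0 = σ

instance instFiniteDimensionalTangentSpaceEuclidean (x : M) :
    FiniteDimensional ℝ (TangentSpace (𝓡 n) x) :=
  inferInstanceAs (FiniteDimensional ℝ (EuclideanSpace ℝ (Fin n)))

variable [RiemannianBundle (fun x : M ↦ TangentSpace (𝓡 n) x)]

/-- The squared norm `|d^v σ|²` with respect to `h_{p,q}`, that is,
`∑ i, h_{p,q}(∇_{E_i} σ, ∇_{E_i} σ)` for an orthonormal basis `E_i` of the tangent space. -/
def verticalEnergyDensity (cov : CovariantDerivative (𝓡 n) F V) (p q : ℝ)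
    (σ : Π x : M, V x) (x : M) : ℝ :=
  ∑ i, verticalMetric p q (σ x)
    (cov σ x (stdOrthonormalBasis ℝ (TangentSpace (𝓡 n) x) i))
    (cov σ x (stdOrthonormalBasis ℝ (TangentSpace (𝓡 n) x) i))

/-- The vertical `(p,q)`-energy of `σ` over `K`. -/
def verticalEnergyOn [MeasurableSpace M] (cov : CovariantDerivative (𝓡 n) F V) (p q : ℝ)
    (K : Set M) (σ : Π x : M, V x) : ℝ :=
  (1 / 2) * ∫ x in K, verticalEnergyDensity cov p q σ x ∂(riemannianVolume n M)

/-- `σ` is a `(p,q)`-harmonic section if it is stationary for the vertical `(p,q)`-energy with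
respect to smooth variations through sections. As `M` need not be compact, the energy is taken over
compact sets outside of which the variation is fixed; when `M` is compact, the choice `K = M` allows
every smooth variation. -/
def IsPQHarmonic [MeasurableSpace M] (cov : CovariantDerivative (𝓡 n) F V) (p q : ℝ)
    (σ : Π x : M, V x) : Prop :=
  ∀ (K : Set M) (s : ℝ → Π x : M, V x), IsCompact K → IsSmoothVariation n F σ s →
    (∀ t : ℝ, ∀ x ∉ K, s t x = σ x) →
    HasDerivAt (fun t : ℝ ↦ verticalEnergyOn cov p q K (s t)) 0 0

end Sections

/-- The region `G₁(ν)` of the `(p,q)`-plane. -/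
def regionG₁ (ν : ℝ) : Set (ℝ × ℝ) := {z | 1 < z.1 ∧ 2 * ν * (1 - z.1) ≤ z.2}

end

/-! Write `u = |σ|²`, `P = |∇σ|²`, `Q = ∑ ⟨∇_i σ, σ⟩² = |∇u|² / 4`, the sum being over an
orthonormal frame.

Parallel sections are critical: if `∇σ = 0`, then `∇σ_t = O(t)` along any smooth variation, so the
energy density, which is quadratic in `∇σ_t`, is `O(t²)`, uniformly on a compact set. Compact sets
have finite volume, hence the energy is `O(t²)` and its derivative at `0` vanishes
(`IsParallelSection.isPQHarmonic`). No differentiation under the integral is needed here.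

Conversely, only the variations `(1 + tφ)σ` with `φ` a bump function in a chart are used. Their
first variation involves `∇φ` only through `(1 + u)^(-p) (1 + qu) ⟨∇φ, ∇u⟩`. As `u` is harmonic,
`∇u` is divergence free, and integration by parts turns this term into `φ` times a multiple of `Q`.
What remains is `∫ φ (1 + u)^(-p-1) ((1 + (1-p)u) P + p(2 + qu) Q) = 0`
(`IsPQHarmonic.integral_mul_bump_eq_zero`). The Riemannian hypothesis on `σ` and the bound on `q`
make both coefficients nonnegative, so the integrand, being continuous and nonnegative, vanishes.
Thus `∇σ = 0` wherever `1 + (1-p)u > 0` (`IsPQHarmonic.cov_eq_zero`).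

For `ν > 1` this inequality holds everywhere. For `ν = 1` it holds at one point. Near any point
where it holds `σ` is parallel and `u` is locally constant, so on a connected manifold the level set
of `u` through that point is everything, and the inequality again holds everywhere.

All of this is computed in charts, so the orthonormal traces, the Riemannian measure and the
covariant derivative must first be expressed in coordinates. -/

noncomputable section

/-- The trace of a bilinear form on an inner product space, computed in an arbitrary basis. -/
lemma sum_orthonormalBasis_eq_sum_inv_gram {W ι κ : Type*} [NormedAddCommGroup W]
    [InnerProductSpace ℝ W] [Fintype ι] [Fintype κ] [DecidableEq ι]
    (e : OrthonormalBasis κ ℝ W) (b : Module.Basis ι ℝ W) (B : W →ₗ[ℝ] W →ₗ[ℝ] ℝ) :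
    ∑ k, B (e k) (e k) =
      ∑ i, ∑ j, (Matrix.of fun i j ↦ (inner ℝ (b i) (b j) : ℝ))⁻¹ i j * B (b i) (b j) := by
  set C : Matrix ι κ ℝ := Matrix.of fun i k ↦ b.repr (e k) i with hC
  have he : ∀ k, e k = ∑ i, C i k • b i := fun k ↦ by simp [hC, b.sum_repr]
  -- With `G` the Gram matrix, `G * C` has entries `⟨e k, b i⟩`, the coordinates of `b i` in the
  -- basis `e`. Multiplying by `Cᵀ` expands `b i` back in `b`, which gives the identity; so `G⁻¹ = C
  -- * Cᵀ`.
  have hinv : (Matrix.of fun i j ↦ (inner ℝ (b i) (b j) : ℝ)) * (C * C.transpose) = 1 := by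
    rw [← Matrix.mul_assoc]
    ext i j
    have h1 : b.repr (b i) j = ∑ k, inner ℝ (e k) (b i) * b.repr (e k) j := by
      conv_lhs => rw [← e.sum_repr' (b i)]
      simp
    have h2 : ∀ k, (Matrix.of (fun i j ↦ (inner ℝ (b i) (b j) : ℝ)) * C) i k
        = inner ℝ (e k) (b i) := fun k ↦ by
      rw [real_inner_comm]
      conv_rhs => rw [he k, inner_sum]
      simp [Matrix.mul_apply, inner_smul_right, mul_comm]
    rw [Matrix.mul_apply]
    simp only [h2, Matrix.transpose_apply]
    simp only [hC, Matrix.of_apply]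
    rw [← h1, b.repr_self, Matrix.one_apply, Finsupp.single_apply]
  rw [Matrix.inv_eq_right_inv hinv]
  calc ∑ k, B (e k) (e k) = ∑ k, ∑ i, ∑ j, C i k * (C j k * B (b i) (b j)) := by
        refine Finset.sum_congr rfl fun k _ ↦ ?_
        conv_lhs => rw [he k]
        simp only [map_sum, map_smul, LinearMap.sum_apply, LinearMap.smul_apply, smul_eq_mul,
          Finset.mul_sum]
        rw [Finset.sum_comm]
        exact Finset.sum_congr rfl fun i _ ↦ Finset.sum_congr rfl fun j _ ↦ by ring
    _ = _ := by
        rw [Finset.sum_comm]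
        refine Finset.sum_congr rfl fun i _ ↦ ?_
        rw [Finset.sum_comm]
        refine Finset.sum_congr rfl fun j _ ↦ ?_
        simp only [Matrix.mul_apply, Matrix.transpose_apply, Finset.sum_mul, mul_assoc]

/-! ### Coordinate vector fields of a chart -/

section Charts

variable {n : ℕ} {M : Type*} [TopologicalSpace M] [ChartedSpace (EuclideanSpace ℝ (Fin n)) M]

variable [IsManifold (𝓡 n) ∞ M]

lemma mdifferentiableAt_extChartAt_symm_of_mem (x₀ : M) {y : EuclideanSpace ℝ (Fin n)}
    (hy : y ∈ (extChartAt (𝓡 n) x₀).target) :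
    MDifferentiableAt (𝓡 n) (𝓡 n) (extChartAt (𝓡 n) x₀).symm y :=
  ((contMDiffOn_extChartAt_symm (n := ∞) x₀).contMDiffAt
    ((isOpen_extChartAt_target x₀).mem_nhds hy)).mdifferentiableAt (by simp)

/-- The field is the tangent map of the inverse chart applied to a constant field of the model
space. -/
lemma contMDiffOn_coordVector (x₀ : M) (i : Fin n) :
    ContMDiffOn (𝓡 n) (𝓡 n).tangent ∞
      (fun y ↦ (⟨(extChartAt (𝓡 n) x₀).symm y, coordVector x₀ i y⟩ : TangentBundle (𝓡 n) M))
      (extChartAt (𝓡 n) x₀).target := by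
  have h := (contMDiffOn_extChartAt_symm (I := 𝓡 n) (n := ∞) x₀).contMDiffOn_tangentMapWithin
    (m := ∞) (by simp) (isOpen_extChartAt_target x₀).uniqueMDiffOn
  have hs : ContMDiff (𝓡 n) (𝓡 n).tangent ∞ (fun y : EuclideanSpace ℝ (Fin n) ↦
      (⟨y, EuclideanSpace.single i (1 : ℝ)⟩ : TangentBundle (𝓡 n) (EuclideanSpace ℝ (Fin n)))) :=
    contMDiff_vectorSpace_iff_contDiff.2 contDiff_const
  refine (h.comp hs.contMDiffOn fun y hy ↦ hy).congr fun y hy ↦ ?_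
  simp only [Function.comp_apply, tangentMapWithin, coordVector]
  rw [mfderivWithin_of_isOpen (isOpen_extChartAt_target x₀) hy]

lemma mfderiv_extChartAt_symm_isInvertible (x₀ : M) {y : EuclideanSpace ℝ (Fin n)}
    (hy : y ∈ (extChartAt (𝓡 n) x₀).target) :
    (mfderiv (𝓡 n) (𝓡 n) (extChartAt (𝓡 n) x₀).symm y).IsInvertible := by
  have := isInvertible_mfderivWithin_extChartAt_symm (I := 𝓡 n) hy
  simpa using this

lemma exists_coordBasis (x₀ : M) {y : EuclideanSpace ℝ (Fin n)}
    (hy : y ∈ (extChartAt (𝓡 n) x₀).target) :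
    ∃ b : Module.Basis (Fin n) ℝ (TangentSpace (𝓡 n) ((extChartAt (𝓡 n) x₀).symm y)),
      ∀ i, b i = coordVector x₀ i y := by
  obtain ⟨L, hL⟩ : ∃ L : EuclideanSpace ℝ (Fin n) ≃L[ℝ]
      TangentSpace (𝓡 n) ((extChartAt (𝓡 n) x₀).symm y), (L : EuclideanSpace ℝ (Fin n) →L[ℝ] _) =
      mfderiv (𝓡 n) (𝓡 n) (extChartAt (𝓡 n) x₀).symm y :=
    mfderiv_extChartAt_symm_isInvertible x₀ hy
  refine ⟨(EuclideanSpace.basisFun (Fin n) ℝ).toBasis.map L.toLinearEquiv, fun i ↦ ?_⟩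
  rw [coordVector, ← hL]
  change L ((EuclideanSpace.basisFun (Fin n) ℝ).toBasis i) = L (EuclideanSpace.single i 1)
  simp

/-- The coordinate vector fields form a basis at each point of the chart. -/
def coordBasis (x₀ : M) {y : EuclideanSpace ℝ (Fin n)} (hy : y ∈ (extChartAt (𝓡 n) x₀).target) :
    Module.Basis (Fin n) ℝ (TangentSpace (𝓡 n) ((extChartAt (𝓡 n) x₀).symm y)) :=
  (exists_coordBasis x₀ hy).choose

lemma coordBasis_apply (x₀ : M) {y : EuclideanSpace ℝ (Fin n)}
    (hy : y ∈ (extChartAt (𝓡 n) x₀).target) (i : Fin n) :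
    coordBasis x₀ hy i = coordVector x₀ i y :=
  (exists_coordBasis x₀ hy).choose_spec i

end Charts

/-! ### The metric, its inverse and its density in coordinates -/

section Gram

variable {n : ℕ} {M : Type*} [TopologicalSpace M] [ChartedSpace (EuclideanSpace ℝ (Fin n)) M]
  [IsManifold (𝓡 n) ∞ M] [RiemannianBundle (fun x : M ↦ TangentSpace (𝓡 n) x)]

lemma gramMatrix_posDef (x₀ : M) {y : EuclideanSpace ℝ (Fin n)}
    (hy : y ∈ (extChartAt (𝓡 n) x₀).target) : (gramMatrix x₀ y).PosDef := by
  have h : gramMatrix x₀ y = Matrix.gram ℝ (coordBasis x₀ hy) := by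
    ext i j
    rw [Matrix.gram_apply, coordBasis_apply, coordBasis_apply]
    rfl
  rw [h]
  exact Matrix.posDef_gram_of_linearIndependent (coordBasis x₀ hy).linearIndependent

lemma gramMatrix_det_pos (x₀ : M) {y : EuclideanSpace ℝ (Fin n)}
    (hy : y ∈ (extChartAt (𝓡 n) x₀).target) : 0 < (gramMatrix x₀ y).det :=
  (gramMatrix_posDef x₀ hy).det_pos

lemma volumeDensity_pos (x₀ : M) {y : EuclideanSpace ℝ (Fin n)}
    (hy : y ∈ (extChartAt (𝓡 n) x₀).target) : 0 < volumeDensity x₀ y :=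
  Real.sqrt_pos.2 (gramMatrix_det_pos x₀ hy)

lemma sum_stdOrthonormalBasis_eq_sum_coord (x₀ : M) {y : EuclideanSpace ℝ (Fin n)}
    (hy : y ∈ (extChartAt (𝓡 n) x₀).target)
    (B : TangentSpace (𝓡 n) ((extChartAt (𝓡 n) x₀).symm y) →ₗ[ℝ]
      TangentSpace (𝓡 n) ((extChartAt (𝓡 n) x₀).symm y) →ₗ[ℝ] ℝ) :
    ∑ k, B (stdOrthonormalBasis ℝ (TangentSpace (𝓡 n) ((extChartAt (𝓡 n) x₀).symm y)) k)
        (stdOrthonormalBasis ℝ (TangentSpace (𝓡 n) ((extChartAt (𝓡 n) x₀).symm y)) k) =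
      ∑ i, ∑ j, (gramMatrix x₀ y)⁻¹ i j * B (coordVector x₀ i y) (coordVector x₀ j y) := by
  rw [sum_orthonormalBasis_eq_sum_inv_gram _ (coordBasis x₀ hy)]
  simp only [coordBasis_apply]
  rfl

variable [IsContMDiffRiemannianBundle (𝓡 n) ∞ (EuclideanSpace ℝ (Fin n))
      (fun x : M ↦ TangentSpace (𝓡 n) x)]

lemma contDiffOn_gramMatrix (x₀ : M) (i j : Fin n) :
    ContDiffOn ℝ ∞ (fun y ↦ gramMatrix x₀ y i j) (extChartAt (𝓡 n) x₀).target := by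
  rw [← contMDiffOn_iff_contDiffOn]
  exact (contMDiffOn_coordVector x₀ i).inner_bundle (contMDiffOn_coordVector x₀ j)

lemma contDiffOn_gramMatrix_det (x₀ : M) :
    ContDiffOn ℝ ∞ (fun y ↦ (gramMatrix x₀ y).det) (extChartAt (𝓡 n) x₀).target := by
  simp only [Matrix.det_apply]
  refine ContDiffOn.sum fun s _ ↦
    (contDiffOn_prod fun i _ ↦ contDiffOn_gramMatrix x₀ _ _).const_smul _

lemma contDiffOn_volumeDensity (x₀ : M) :
    ContDiffOn ℝ ∞ (volumeDensity x₀) (extChartAt (𝓡 n) x₀).target :=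
  (contDiffOn_gramMatrix_det x₀).sqrt fun _ hy ↦ (gramMatrix_det_pos x₀ hy).ne'

/-- The entries of the inverse of a matrix with `C^k` entries are `C^k` where it is invertible. -/
lemma contDiffOn_matrix_inv {E ι : Type*} [NormedAddCommGroup E] [NormedSpace ℝ E] [Fintype ι]
    [DecidableEq ι] {k : WithTop ℕ∞} {A : E → Matrix ι ι ℝ} {s : Set E}
    (hA : ∀ i j, ContDiffOn ℝ k (fun y ↦ A y i j) s) (hdet : ∀ y ∈ s, (A y).det ≠ 0) (i j : ι) :
    ContDiffOn ℝ k (fun y ↦ (A y)⁻¹ i j) s := by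
  have hd : ∀ B : E → Matrix ι ι ℝ, (∀ i j, ContDiffOn ℝ k (fun y ↦ B y i j) s) →
      ContDiffOn ℝ k (fun y ↦ (B y).det) s := fun B hB ↦ by
    simp only [Matrix.det_apply]
    exact ContDiffOn.sum fun s _ ↦ (contDiffOn_prod fun i _ ↦ hB _ _).const_smul _
  -- Cramer's rule: each entry of the inverse is a determinant of entries of `A`, zeros and ones,
  -- divided by `det A`.
  simp only [Matrix.inv_def, Matrix.smul_apply, smul_eq_mul, Ring.inverse_eq_inv',
    Matrix.adjugate_apply]
  refine ((hd A hA).inv hdet).mul (hd _ fun a b ↦ ?_)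
  by_cases h : a = j
  · subst h
    simpa using contDiffOn_const
  · simpa [Matrix.updateRow_ne h] using hA a b

lemma contDiffOn_gramMatrix_inv (x₀ : M) (i j : Fin n) :
    ContDiffOn ℝ ∞ (fun y ↦ (gramMatrix x₀ y)⁻¹ i j) (extChartAt (𝓡 n) x₀).target :=
  contDiffOn_matrix_inv (contDiffOn_gramMatrix x₀) (fun _ hy ↦ (gramMatrix_det_pos x₀ hy).ne') i j

end Gram

/-! ### The Riemannian measure: independence of the chart, local finiteness, integrals in
coordinates -/

section Volume

variable {n : ℕ} {M : Type*} [TopologicalSpace M] [ChartedSpace (EuclideanSpace ℝ (Fin n)) M]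
  [IsManifold (𝓡 n) ∞ M]

lemma differentiableAt_chart_change (x₀ x₁ : M) {y : EuclideanSpace ℝ (Fin n)}
    (hy : y ∈ (extChartAt (𝓡 n) x₁).target)
    (hy₀ : (extChartAt (𝓡 n) x₁).symm y ∈ (extChartAt (𝓡 n) x₀).source) :
    DifferentiableAt ℝ (extChartAt (𝓡 n) x₀ ∘ (extChartAt (𝓡 n) x₁).symm) y := by
  rw [← mdifferentiableAt_iff_differentiableAt]
  refine MDifferentiableAt.comp y (I' := 𝓡 n) ?_ (mdifferentiableAt_extChartAt_symm_of_mem x₁ hy)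
  exact ((contMDiffOn_extChartAt (I := 𝓡 n) (n := ∞) (x := x₀)).contMDiffAt
    ((chartAt _ x₀).open_source.mem_nhds (by simpa using hy₀))).mdifferentiableAt (by simp)

/-- Chain rule for `ψ₁ = ψ₀ ∘ κ` near `y`, where `ψ₀`, `ψ₁` are the inverse charts and `κ` is the
transition map. The two base points are equal but not definitionally so; the identity is therefore
stated in the common model space. -/
lemma mfderiv_extChartAt_symm_chart_change (x₀ x₁ : M) {y : EuclideanSpace ℝ (Fin n)}
    (hy : y ∈ (extChartAt (𝓡 n) x₁).target)
    (hy₀ : (extChartAt (𝓡 n) x₁).symm y ∈ (extChartAt (𝓡 n) x₀).source)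
    (v : EuclideanSpace ℝ (Fin n)) :
    (mfderiv (𝓡 n) (𝓡 n) (extChartAt (𝓡 n) x₁).symm y v : EuclideanSpace ℝ (Fin n)) =
      mfderiv (𝓡 n) (𝓡 n) (extChartAt (𝓡 n) x₀).symm
        (extChartAt (𝓡 n) x₀ ((extChartAt (𝓡 n) x₁).symm y))
        (fderiv ℝ (extChartAt (𝓡 n) x₀ ∘ (extChartAt (𝓡 n) x₁).symm) y v) := by
  have hev : (extChartAt (𝓡 n) x₁).symm =ᶠ[nhds y] (extChartAt (𝓡 n) x₀).symm ∘
      (extChartAt (𝓡 n) x₀ ∘ (extChartAt (𝓡 n) x₁).symm) := by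
    have h1 : ∀ᶠ z in nhds y, (extChartAt (𝓡 n) x₁).symm z ∈ (extChartAt (𝓡 n) x₀).source :=
      ((continuousOn_extChartAt_symm x₁).continuousAt
        ((isOpen_extChartAt_target x₁).mem_nhds hy)).eventually
        ((isOpen_extChartAt_source x₀).mem_nhds hy₀)
    filter_upwards [h1] with z hz
    exact ((extChartAt (𝓡 n) x₀).left_inv hz).symm
  have hd := differentiableAt_chart_change x₀ x₁ hy hy₀
  have h2 := hev.mfderiv_eq (I := 𝓡 n) (I' := 𝓡 n)
  have h3 := mfderiv_comp (I := 𝓡 n) (I' := 𝓡 n) (I'' := 𝓡 n) y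
    (g := (extChartAt (𝓡 n) x₀).symm)
    (mdifferentiableAt_extChartAt_symm_of_mem x₀ ((extChartAt (𝓡 n) x₀).map_source hy₀))
    hd.mdifferentiableAt
  rw [mfderiv_eq_fderiv] at h3
  exact congrArg (fun L : EuclideanSpace ℝ (Fin n) →L[ℝ] EuclideanSpace ℝ (Fin n) ↦ L v)
    (h2.trans h3)

variable [RiemannianBundle (fun x : M ↦ TangentSpace (𝓡 n) x)]

-- All tangent spaces are the same model space as types, but their inner products depend on the base
-- point; this transports an inner product along an equality of points.
omit [IsManifold (𝓡 n) ∞ M] in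
lemma inner_tangentSpace_congr {x x' : M} (h : x = x') (v w : EuclideanSpace ℝ (Fin n)) :
    @inner ℝ (TangentSpace (𝓡 n) x) _ v w = @inner ℝ (TangentSpace (𝓡 n) x') _ v w := by
  subst h; rfl

/-- The coordinate fields of one chart are combinations of those of the other, with the columns of
the Jacobian matrix `J` as coefficients; the rest is bilinearity. -/
lemma gramMatrix_chart_change (x₀ x₁ : M) {y : EuclideanSpace ℝ (Fin n)}
    (hy : y ∈ (extChartAt (𝓡 n) x₁).target)
    (hy₀ : (extChartAt (𝓡 n) x₁).symm y ∈ (extChartAt (𝓡 n) x₀).source)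
    {J : Matrix (Fin n) (Fin n) ℝ} (hJ : J = LinearMap.toMatrix
      (EuclideanSpace.basisFun (Fin n) ℝ).toBasis (EuclideanSpace.basisFun (Fin n) ℝ).toBasis
      (fderiv ℝ (extChartAt (𝓡 n) x₀ ∘ (extChartAt (𝓡 n) x₁).symm) y).toLinearMap) :
    gramMatrix x₁ y =
      J.transpose * gramMatrix x₀ (extChartAt (𝓡 n) x₀ ((extChartAt (𝓡 n) x₁).symm y)) * J := by
  set κ := extChartAt (𝓡 n) x₀ ∘ (extChartAt (𝓡 n) x₁).symm with hκ
  have hpt : (extChartAt (𝓡 n) x₁).symm y = (extChartAt (𝓡 n) x₀).symm (κ y) :=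
    ((extChartAt (𝓡 n) x₀).left_inv hy₀).symm
  have hcol : ∀ i, fderiv ℝ κ y (EuclideanSpace.single i (1 : ℝ)) =
      ∑ k, J k i • EuclideanSpace.single k (1 : ℝ) := fun i ↦ by
    have := (EuclideanSpace.basisFun (Fin n) ℝ).toBasis.sum_repr
      (fderiv ℝ κ y (EuclideanSpace.single i (1 : ℝ)))
    rw [← this]
    simp [hJ, LinearMap.toMatrix_apply]
  have hvec : ∀ i, (coordVector x₁ i y : EuclideanSpace ℝ (Fin n)) =
      ∑ k, J k i • (coordVector x₀ k (κ y)) := fun i ↦ by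
    rw [coordVector, mfderiv_extChartAt_symm_chart_change x₀ x₁ hy hy₀, hcol]
    let L : EuclideanSpace ℝ (Fin n) →L[ℝ] EuclideanSpace ℝ (Fin n) :=
      mfderiv (𝓡 n) (𝓡 n) (extChartAt (𝓡 n) x₀).symm (κ y)
    change L (∑ k, J k i • EuclideanSpace.single k (1 : ℝ)) =
      ∑ k, J k i • L (EuclideanSpace.single k (1 : ℝ))
    simp only [map_sum, map_smul]
  ext i j
  have : gramMatrix x₁ y i j = inner ℝ (∑ k, J k i • (coordVector x₀ k (κ y)))
      (∑ k, J k j • (coordVector x₀ k (κ y))) := by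
    rw [← hvec i, ← hvec j]
    exact inner_tangentSpace_congr hpt (coordVector x₁ i y) (coordVector x₁ j y)
  rw [this, sum_inner]
  simp only [inner_sum, real_inner_smul_left, real_inner_smul_right, Matrix.mul_apply,
    Matrix.transpose_apply, Finset.sum_mul]
  rw [Finset.sum_comm]
  refine Finset.sum_congr rfl fun l _ ↦ Finset.sum_congr rfl fun k _ ↦ ?_
  change _ = J k i * inner ℝ (coordVector x₀ k (κ y)) (coordVector x₀ l (κ y)) * J l j
  ring

lemma volumeDensity_chart_change (x₀ x₁ : M) {y : EuclideanSpace ℝ (Fin n)}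
    (hy : y ∈ (extChartAt (𝓡 n) x₁).target)
    (hy₀ : (extChartAt (𝓡 n) x₁).symm y ∈ (extChartAt (𝓡 n) x₀).source) :
    volumeDensity x₁ y =
      |(fderiv ℝ (extChartAt (𝓡 n) x₀ ∘ (extChartAt (𝓡 n) x₁).symm) y).det| *
        volumeDensity x₀ (extChartAt (𝓡 n) x₀ ((extChartAt (𝓡 n) x₁).symm y)) := by
  rw [volumeDensity, gramMatrix_chart_change x₀ x₁ hy hy₀ rfl, Matrix.det_mul, Matrix.det_mul,
    Matrix.det_transpose, LinearMap.det_toMatrix, mul_right_comm, Real.sqrt_mul (mul_self_nonneg _),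
    Real.sqrt_mul_self_eq_abs]
  rfl

variable [MeasurableSpace M] [BorelSpace M]

omit [IsManifold (𝓡 n) ∞ M] [RiemannianBundle (fun x : M ↦ TangentSpace (𝓡 n) x)] in
lemma measurableSet_chart_preimage (x₀ : M) {A : Set M} (hA : MeasurableSet A) :
    MeasurableSet ((extChartAt (𝓡 n) x₀).target ∩ (extChartAt (𝓡 n) x₀).symm ⁻¹' A) := by
  have h := (continuousOn_extChartAt_symm (I := 𝓡 n) x₀).domRestrict.measurable hA
  convert (isOpen_extChartAt_target (I := 𝓡 n) x₀).measurableSet.subtype_image h using 1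
  ext y
  simp [and_comm]

omit [IsManifold (𝓡 n) ∞ M] in
lemma aemeasurable_extChartAt_symm (x₀ : M) :
    AEMeasurable (extChartAt (𝓡 n) x₀).symm
      ((volume.restrict (extChartAt (𝓡 n) x₀).target).withDensity
        fun y ↦ ENNReal.ofReal (volumeDensity x₀ y)) :=
  ((continuousOn_extChartAt_symm x₀).aemeasurable
    (isOpen_extChartAt_target x₀).measurableSet).mono_ac (withDensity_absolutelyContinuous _ _)

omit [IsManifold (𝓡 n) ∞ M] in
lemma chartVolume_apply (x₀ : M) {A : Set M} (hA : MeasurableSet A) :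
    chartVolume n x₀ A =
      ∫⁻ y in (extChartAt (𝓡 n) x₀).target ∩ (extChartAt (𝓡 n) x₀).symm ⁻¹' A,
        ENNReal.ofReal (volumeDensity x₀ y) := by
  rw [chartVolume, Measure.map_apply_of_aemeasurable (aemeasurable_extChartAt_symm x₀) hA,
    withDensity_apply', Measure.restrict_restrict' (isOpen_extChartAt_target x₀).measurableSet,
    Set.inter_comm]

/-- Change of variables along the transition map. It is only an inequality because `A` may leave the
domain of the chart around `x₁`, where `chartVolume n x₁` has no mass. -/
lemma chartVolume_le_of_subset_source (x₀ x₁ : M) {A : Set M} (hA : MeasurableSet A)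
    (hA₀ : A ⊆ (extChartAt (𝓡 n) x₀).source) : chartVolume n x₁ A ≤ chartVolume n x₀ A := by
  rw [chartVolume_apply x₁ hA, chartVolume_apply x₀ hA]
  set κ := extChartAt (𝓡 n) x₀ ∘ (extChartAt (𝓡 n) x₁).symm with hκ
  set S := (extChartAt (𝓡 n) x₁).target ∩ (extChartAt (𝓡 n) x₁).symm ⁻¹' A
  have hS : MeasurableSet S := measurableSet_chart_preimage x₁ hA
  have hinj : Set.InjOn κ S := fun y hy z hz h ↦
    (extChartAt (𝓡 n) x₁).symm.injOn hy.1 hz.1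
      ((extChartAt (𝓡 n) x₀).injOn (hA₀ hy.2) (hA₀ hz.2) h)
  calc ∫⁻ y in S, ENNReal.ofReal (volumeDensity x₁ y)
      = ∫⁻ y in S, ENNReal.ofReal |(fderiv ℝ κ y).det| *
          ENNReal.ofReal (volumeDensity x₀ (κ y)) := by
        refine setLIntegral_congr_fun hS fun y hy ↦ ?_
        rw [← ENNReal.ofReal_mul (abs_nonneg _)]
        exact congrArg _ (volumeDensity_chart_change x₀ x₁ hy.1 (hA₀ hy.2))
    _ = ∫⁻ z in κ '' S, ENNReal.ofReal (volumeDensity x₀ z) :=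
        (lintegral_image_eq_lintegral_abs_det_fderiv_mul volume hS (fun y hy ↦
          (differentiableAt_chart_change x₀ x₁ hy.1 (hA₀ hy.2)).hasFDerivAt.hasFDerivWithinAt) hinj
          fun z ↦ ENNReal.ofReal (volumeDensity x₀ z)).symm
    _ ≤ _ := by
        refine lintegral_mono_set ?_
        rintro _ ⟨y, hy, rfl⟩
        exact ⟨(extChartAt (𝓡 n) x₀).map_source (hA₀ hy.2), by
          rw [Set.mem_preimage, hκ, Function.comp_apply, (extChartAt (𝓡 n) x₀).left_inv (hA₀ hy.2)]
          exact hy.2⟩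

/-- On a chart domain the Riemannian volume is the volume of the chart. -/
lemma riemannianVolume_restrict_source (x₀ : M) :
    (riemannianVolume n M).restrict (extChartAt (𝓡 n) x₀).source =
      (chartVolume n x₀).restrict (extChartAt (𝓡 n) x₀).source := by
  have hU : MeasurableSet (extChartAt (𝓡 n) x₀).source :=
    (isOpen_extChartAt_source x₀).measurableSet
  refine le_antisymm ?_ (Measure.restrict_mono le_rfl (le_iSup (chartVolume n) x₀))
  -- Off the chart domain the other chart volumes are bounded crudely by `⊤`; restricting to the
  -- domain afterwards removes this term.
  have hle : riemannianVolume n M ≤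
      chartVolume n x₀ + (⊤ : Measure M).restrict (extChartAt (𝓡 n) x₀).sourceᶜ := by
    refine iSup_le fun x₁ ↦ ?_
    rw [← Measure.restrict_add_restrict_compl (μ := chartVolume n x₁) hU]
    refine add_le_add (Measure.le_iff.2 fun A hA ↦ ?_) (Measure.restrict_mono le_rfl le_top)
    rw [Measure.restrict_apply hA]
    exact (chartVolume_le_of_subset_source x₀ x₁ (hA.inter hU) Set.inter_subset_right).trans
      (measure_mono Set.inter_subset_left)
  refine (Measure.restrict_mono le_rfl hle).trans ?_
  rw [Measure.restrict_add, Measure.restrict_restrict hU]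
  simp

lemma riemannianVolume_restrict_of_subset (x₀ : M) {K : Set M}
    (hK : K ⊆ (extChartAt (𝓡 n) x₀).source) :
    (riemannianVolume n M).restrict K = (chartVolume n x₀).restrict K := by
  rw [← Measure.restrict_restrict_of_subset hK, riemannianVolume_restrict_source,
    Measure.restrict_restrict_of_subset hK]

/-- The density is continuous, hence bounded near the centre of the chart, and balls of the model
space have finite volume. -/
lemma exists_nhds_riemannianVolume_lt_top
    [IsContMDiffRiemannianBundle (𝓡 n) ∞ (EuclideanSpace ℝ (Fin n))
      (fun x : M ↦ TangentSpace (𝓡 n) x)] (x₀ : M) :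
    ∃ U ∈ nhds x₀, riemannianVolume n M U < ⊤ := by
  set e := extChartAt (𝓡 n) x₀ with he
  have hD : ContinuousAt (volumeDensity x₀) (e x₀) :=
    (contDiffOn_volumeDensity x₀).continuousOn.continuousAt (extChartAt_target_mem_nhds x₀)
  obtain ⟨V, hV, hVo, hxV⟩ := mem_nhds_iff.1 (Filter.inter_mem
    (hD.eventually (gt_mem_nhds (lt_add_one _))) (Metric.ball_mem_nhds (e x₀) one_pos))
  have hUo : IsOpen (e.source ∩ e ⁻¹' V) :=
    (continuousOn_extChartAt x₀).isOpen_inter_preimage (isOpen_extChartAt_source x₀) hVo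
  refine ⟨e.source ∩ e ⁻¹' V, hUo.mem_nhds ⟨mem_extChartAt_source x₀, hxV⟩, ?_⟩
  rw [← Measure.restrict_apply_self, riemannianVolume_restrict_of_subset x₀ Set.inter_subset_left,
    Measure.restrict_apply_self, chartVolume_apply x₀ hUo.measurableSet]
  calc _ ≤ ∫⁻ y in V, ENNReal.ofReal (volumeDensity x₀ y) := by
        refine lintegral_mono_set ?_
        rintro y ⟨hy, hy'⟩
        have := hy'.2
        rwa [Set.mem_preimage, e.right_inv hy] at this
    _ ≤ ∫⁻ y in V, ENNReal.ofReal (volumeDensity x₀ (e x₀) + 1) :=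
        setLIntegral_mono' hVo.measurableSet fun y hy ↦ ENNReal.ofReal_le_ofReal (hV hy).1.le
    _ < ⊤ := by
        rw [setLIntegral_const]
        exact ENNReal.mul_lt_top ENNReal.ofReal_lt_top
          ((measure_mono (fun y hy ↦ (hV hy).2)).trans_lt measure_ball_lt_top)

lemma riemannianVolume_lt_top_of_isCompact
    [IsContMDiffRiemannianBundle (𝓡 n) ∞ (EuclideanSpace ℝ (Fin n))
      (fun x : M ↦ TangentSpace (𝓡 n) x)] {K : Set M} (hK : IsCompact K) :
    riemannianVolume n M K < ⊤ := by
  refine hK.measure_lt_top_of_nhdsWithin fun x _ ↦ ?_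
  obtain ⟨U, hU, hlt⟩ := exists_nhds_riemannianVolume_lt_top (n := n) x
  exact ⟨U, mem_nhdsWithin_of_mem_nhds hU, hlt⟩

/-- Integrals over a subset of a chart domain, in coordinates. -/
lemma setIntegral_riemannianVolume [T2Space M]
    [IsContMDiffRiemannianBundle (𝓡 n) ∞ (EuclideanSpace ℝ (Fin n))
      (fun x : M ↦ TangentSpace (𝓡 n) x)] (x₀ : M) {K : Set (EuclideanSpace ℝ (Fin n))}
    (hK : IsCompact K) (hKT : K ⊆ (extChartAt (𝓡 n) x₀).target) {f : M → ℝ}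
    (hf : ContinuousOn (f ∘ (extChartAt (𝓡 n) x₀).symm) (extChartAt (𝓡 n) x₀).target) :
    ∫ x in (extChartAt (𝓡 n) x₀).symm '' K, f x ∂(riemannianVolume n M) =
      ∫ y in K, volumeDensity x₀ y * f ((extChartAt (𝓡 n) x₀).symm y) := by
  set e := extChartAt (𝓡 n) x₀ with he
  have hKU : e.symm '' K ⊆ e.source := by
    rintro _ ⟨y, hy, rfl⟩
    exact e.map_target (hKT hy)
  have hKc : IsCompact (e.symm '' K) :=
    hK.image_of_continuousOn ((continuousOn_extChartAt_symm x₀).mono hKT)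
  have hfU : ContinuousOn f e.source := by
    refine (hf.comp (continuousOn_extChartAt x₀) fun x hx ↦ e.map_source hx).congr fun x hx ↦ ?_
    rw [Function.comp_apply, Function.comp_apply, e.left_inv hx]
  have hT : MeasurableSet e.target := (isOpen_extChartAt_target x₀).measurableSet
  have hDm : AEMeasurable (fun y ↦ ENNReal.ofReal (volumeDensity x₀ y))
      (volume.restrict e.target) :=
    ((contDiffOn_volumeDensity x₀).continuousOn.aemeasurable hT).ennreal_ofReal
  rw [riemannianVolume_restrict_of_subset x₀ hKU, ← integral_indicator hKc.measurableSet,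
    chartVolume, integral_map (aemeasurable_extChartAt_symm x₀),
    integral_withDensity_eq_integral_toReal_smul₀ hDm (by simp)]
  · rw [← integral_indicator hT, ← integral_indicator hK.measurableSet]
    refine integral_congr_ae (Filter.Eventually.of_forall fun y ↦ ?_)
    by_cases hy : y ∈ e.target
    · have hiff : e.symm y ∈ e.symm '' K ↔ y ∈ K :=
        ⟨fun ⟨z, hz, hzy⟩ ↦ e.symm.injOn (hKT hz) hy hzy ▸ hz, fun h ↦ ⟨y, h, rfl⟩⟩
      by_cases hyK : y ∈ K
      · rw [Set.indicator_of_mem hy, Set.indicator_of_mem hyK, Set.indicator_of_mem (hiff.2 hyK),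
          ENNReal.toReal_ofReal (volumeDensity_pos x₀ hy).le, smul_eq_mul]
      · rw [Set.indicator_of_mem hy, Set.indicator_of_notMem hyK,
          Set.indicator_of_notMem (mt hiff.1 hyK), smul_zero]
    · have hyK : y ∉ K := fun h ↦ hy (hKT h)
      simp [hy, hyK]
  · rw [aestronglyMeasurable_indicator_iff hKc.measurableSet]
    exact (hfU.mono hKU).aestronglyMeasurable hKc.measurableSet

end Volume

/-! ### Covariant derivative and energy density in coordinates -/

section SectionsInCoordinates

variable {n : ℕ} {M : Type*} [TopologicalSpace M] [ChartedSpace (EuclideanSpace ℝ (Fin n)) M]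
  [IsManifold (𝓡 n) ∞ M]
  {F : Type*} [NormedAddCommGroup F] [NormedSpace ℝ F]
  {V : M → Type*} [TopologicalSpace (TotalSpace F V)]
  [∀ x, NormedAddCommGroup (V x)] [∀ x, InnerProductSpace ℝ (V x)] [FiberBundle F V]

/-- The covariant derivative of a section along a coordinate vector field. -/
def covCoord (cov : CovariantDerivative (𝓡 n) F V) (σ : Π x : M, V x) (x₀ : M) (i : Fin n)
    (y : EuclideanSpace ℝ (Fin n)) : V ((extChartAt (𝓡 n) x₀).symm y) :=
  cov σ ((extChartAt (𝓡 n) x₀).symm y) (coordVector x₀ i y)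

omit [∀ x, InnerProductSpace ℝ (V x)] in
lemma contMDiffOn_section_comp_symm {σ : Π x : M, V x} (hσ : IsSmoothSection n F σ) (x₀ : M) :
    ContMDiffOn (𝓡 n) ((𝓡 n).prod 𝓘(ℝ, F)) ∞
      (fun y ↦ (⟨(extChartAt (𝓡 n) x₀).symm y, σ ((extChartAt (𝓡 n) x₀).symm y)⟩ :
        TotalSpace F V)) (extChartAt (𝓡 n) x₀).target :=
  ContMDiff.comp_contMDiffOn hσ (contMDiffOn_extChartAt_symm x₀)

lemma mvfderiv_coordVector (x₀ : M) {y : EuclideanSpace ℝ (Fin n)}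
    (hy : y ∈ (extChartAt (𝓡 n) x₀).target) {f : M → ℝ}
    (hf : MDifferentiableAt (𝓡 n) 𝓘(ℝ, ℝ) f ((extChartAt (𝓡 n) x₀).symm y)) (i : Fin n) :
    mvfderiv (𝓡 n) f ((extChartAt (𝓡 n) x₀).symm y) (coordVector x₀ i y) =
      fderiv ℝ (f ∘ (extChartAt (𝓡 n) x₀).symm) y (EuclideanSpace.single i (1 : ℝ)) := by
  have h := mfderiv_comp (I := 𝓡 n) (I' := 𝓡 n) (I'' := 𝓘(ℝ, ℝ)) y hf
    (mdifferentiableAt_extChartAt_symm_of_mem x₀ hy)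
  rw [mfderiv_eq_fderiv] at h
  exact (congrArg (fun L : EuclideanSpace ℝ (Fin n) →L[ℝ] ℝ ↦ L (EuclideanSpace.single i (1 : ℝ)))
    h).symm

lemma covCoord_smul (cov : CovariantDerivative (𝓡 n) F V) {σ : Π x : M, V x} {f : M → ℝ} (x₀ : M)
    {y : EuclideanSpace ℝ (Fin n)} (hy : y ∈ (extChartAt (𝓡 n) x₀).target)
    (hσ : IsSmoothSection n F σ) (hf : ContMDiff (𝓡 n) 𝓘(ℝ, ℝ) ∞ f) (i : Fin n) :
    covCoord cov (f • σ) x₀ i y = f ((extChartAt (𝓡 n) x₀).symm y) • covCoord cov σ x₀ i y +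
      fderiv ℝ (f ∘ (extChartAt (𝓡 n) x₀).symm) y (EuclideanSpace.single i (1 : ℝ)) •
        σ ((extChartAt (𝓡 n) x₀).symm y) := by
  have hf' : MDifferentiableAt (𝓡 n) 𝓘(ℝ, ℝ) f ((extChartAt (𝓡 n) x₀).symm y) :=
    hf.mdifferentiableAt (by simp)
  rw [covCoord, cov.isCovariantDerivativeOn.leibniz (hσ.mdifferentiableAt (by simp)) hf'
    (Set.mem_univ _), ← mvfderiv_coordVector x₀ hy hf']
  rfl

section Metric

variable [VectorBundle ℝ F V]

lemma contMDiffOn_covCoord {cov : CovariantDerivative (𝓡 n) F V}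
    (hsmooth : cov.ContMDiffCovariantDerivative ∞) {σ : Π x : M, V x}
    (hσ : IsSmoothSection n F σ) (x₀ : M) (i : Fin n) :
    ContMDiffOn (𝓡 n) ((𝓡 n).prod 𝓘(ℝ, F)) ∞
      (fun y ↦ (⟨(extChartAt (𝓡 n) x₀).symm y, covCoord cov σ x₀ i y⟩ : TotalSpace F V))
      (extChartAt (𝓡 n) x₀).target := by
  have h := hsmooth.contMDiff.contMDiff (σ := σ) (ContMDiff.contMDiffOn hσ)
  rw [contMDiffOn_univ] at h
  exact (h.comp_contMDiffOn (contMDiffOn_extChartAt_symm x₀)).clm_bundle_apply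
    (contMDiffOn_coordVector x₀ i)

variable [IsContMDiffRiemannianBundle (𝓡 n) ∞ F V]

omit [IsManifold (𝓡 n) ∞ M] in
lemma contDiffOn_inner_of_contMDiffOn {x₀ : M}
    {v w : ∀ y, V ((extChartAt (𝓡 n) x₀).symm y)}
    (hv : ContMDiffOn (𝓡 n) ((𝓡 n).prod 𝓘(ℝ, F)) ∞
      (fun y ↦ (⟨(extChartAt (𝓡 n) x₀).symm y, v y⟩ : TotalSpace F V))
      (extChartAt (𝓡 n) x₀).target)
    (hw : ContMDiffOn (𝓡 n) ((𝓡 n).prod 𝓘(ℝ, F)) ∞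
      (fun y ↦ (⟨(extChartAt (𝓡 n) x₀).symm y, w y⟩ : TotalSpace F V))
      (extChartAt (𝓡 n) x₀).target) :
    ContDiffOn ℝ ∞ (fun y ↦ (inner ℝ (v y) (w y) : ℝ)) (extChartAt (𝓡 n) x₀).target := by
  rw [← contMDiffOn_iff_contDiffOn]
  exact hv.inner_bundle hw

variable [FiniteDimensional ℝ F] [ContMDiffVectorBundle ∞ F V (𝓡 n)]

lemma fderiv_inner_section {cov : CovariantDerivative (𝓡 n) F V}
    (hmetric : cov.IsMetricCompatible) {σ τ : Π x : M, V x}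
    (hσ : IsSmoothSection n F σ) (hτ : IsSmoothSection n F τ) (x₀ : M)
    {y : EuclideanSpace ℝ (Fin n)} (hy : y ∈ (extChartAt (𝓡 n) x₀).target) (i : Fin n) :
    fderiv ℝ ((fun x ↦ (inner ℝ (σ x) (τ x) : ℝ)) ∘ (extChartAt (𝓡 n) x₀).symm) y
        (EuclideanSpace.single i (1 : ℝ)) =
      inner ℝ (covCoord cov σ x₀ i y) (τ ((extChartAt (𝓡 n) x₀).symm y)) +
        inner ℝ (σ ((extChartAt (𝓡 n) x₀).symm y)) (covCoord cov τ x₀ i y) := by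
  classical
  set x := (extChartAt (𝓡 n) x₀).symm y with hx
  have hσ' : MDifferentiableAt (𝓡 n) ((𝓡 n).prod 𝓘(ℝ, F))
    (fun x : M ↦ (⟨x, σ x⟩ : TotalSpace F V)) x := hσ.mdifferentiableAt (by simp)
  have hτ' : MDifferentiableAt (𝓡 n) ((𝓡 n).prod 𝓘(ℝ, F))
    (fun x : M ↦ (⟨x, τ x⟩ : TotalSpace F V)) x := hτ.mdifferentiableAt (by simp)
  -- Metric compatibility is stated for a vector field, but only its value at `x` enters, so a field
  -- vanishing elsewhere suffices.
  have h := hmetric.mvfderiv_inner_eq (x := x)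
    (Function.update (fun _ ↦ 0) x (coordVector x₀ i y)) hσ' hτ'
  rw [← mvfderiv_coordVector x₀ hy (hσ'.inner_bundle hτ')]
  simp only [Function.update_self] at h
  exact h

end Metric

variable [RiemannianBundle (fun x : M ↦ TangentSpace (𝓡 n) x)]

lemma verticalEnergyDensity_eq_sum_coord (cov : CovariantDerivative (𝓡 n) F V) (p q : ℝ)
    (σ : Π x : M, V x) (x₀ : M) {y : EuclideanSpace ℝ (Fin n)}
    (hy : y ∈ (extChartAt (𝓡 n) x₀).target) :
    verticalEnergyDensity cov p q σ ((extChartAt (𝓡 n) x₀).symm y) =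
      ∑ i, ∑ j, (gramMatrix x₀ y)⁻¹ i j * verticalMetric p q (σ ((extChartAt (𝓡 n) x₀).symm y))
        (covCoord cov σ x₀ i y) (covCoord cov σ x₀ j y) := by
  set x := (extChartAt (𝓡 n) x₀).symm y with hx
  exact sum_stdOrthonormalBasis_eq_sum_coord x₀ hy (LinearMap.mk₂ ℝ
    (fun v w ↦ verticalMetric p q (σ x) (cov σ x v) (cov σ x w))
    (fun _ _ _ ↦ by simp only [verticalMetric, map_add, inner_add_left]; ring)
    (fun _ _ _ ↦ by simp only [verticalMetric, map_smul, real_inner_smul_left, smul_eq_mul]; ring)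
    (fun _ _ _ ↦ by
      simp only [verticalMetric, map_add, inner_add_left, inner_add_right]; ring)
    (fun _ _ _ ↦ by
      simp only [verticalMetric, map_smul, real_inner_smul_left, real_inner_smul_right,
        smul_eq_mul]; ring))

end SectionsInCoordinates

/-! ### Functions of a point and of the variation parameter -/

open Filter Topology Asymptotics in
/-- A `C¹` function vanishing on the slice `t = 0` is `O(t)` near this slice. -/
lemma isBigO_snd_of_contDiffAt {E : Type*} [NormedAddCommGroup E] [NormedSpace ℝ E]
    {f : E × ℝ → ℝ} {y₀ : E} (hf : ContDiffAt ℝ 1 f (y₀, 0)) (h0 : ∀ᶠ y in 𝓝 y₀, f (y, 0) = 0) :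
    f =O[𝓝 (y₀, 0)] fun z ↦ z.2 := by
  -- A `C¹` function is locally Lipschitz; compare its values at `(y, t)` and `(y, 0)`, which lie at
  -- distance `|t|`.
  obtain ⟨K, U, hU, hK⟩ := hf.exists_lipschitzOnWith
  have hproj : Tendsto (fun z : E × ℝ ↦ ((z.1, 0) : E × ℝ)) (𝓝 (y₀, 0)) (𝓝 (y₀, 0)) :=
    Continuous.tendsto' (by fun_prop) _ _ rfl
  have h0' : ∀ᶠ z : E × ℝ in 𝓝 (y₀, 0), f (z.1, 0) = 0 :=
    (continuous_fst.tendsto' ((y₀, 0) : E × ℝ) y₀ rfl).eventually h0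
  refine IsBigO.of_bound K ?_
  filter_upwards [hU, hproj.eventually hU, h0'] with z hz hz' hz0
  have := hK.dist_le_mul z hz _ hz'
  rwa [hz0, Prod.dist_eq, dist_self, max_eq_right dist_nonneg, dist_zero_right, dist_zero_right]
    at this

lemma fderiv_slice {E : Type*} [NormedAddCommGroup E] [NormedSpace ℝ E] {f : E × ℝ → ℝ} {y : E}
    {t : ℝ} (hf : DifferentiableAt ℝ f (y, t)) (v : E) :
    fderiv ℝ (fun x ↦ f (x, t)) y v = fderiv ℝ f (y, t) (v, 0) := by
  have h := HasFDerivAt.comp (g := f) (f := fun x : E ↦ (x, t)) y hf.hasFDerivAt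
    (hasFDerivAt_prodMk_left y t)
  have h' : HasFDerivAt (fun x ↦ f (x, t)) _ y := h
  rw [h'.fderiv]
  simp

/-! ### Parallel sections are critical points of the energy -/

section Variation

variable {n : ℕ} {M : Type*} [TopologicalSpace M] [ChartedSpace (EuclideanSpace ℝ (Fin n)) M]
  [IsManifold (𝓡 n) ∞ M]
  {F : Type*} [NormedAddCommGroup F] [NormedSpace ℝ F]
  {V : M → Type*} [TopologicalSpace (TotalSpace F V)]
  [∀ x, NormedAddCommGroup (V x)] [∀ x, InnerProductSpace ℝ (V x)] [FiberBundle F V]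

/-- Near each point there is a frame consisting of globally defined smooth sections. -/
lemma exists_smooth_frame [T2Space M] [FiniteDimensional ℝ F] [VectorBundle ℝ F V]
    [ContMDiffVectorBundle ∞ F V (𝓡 n)] (x₀ : M) :
    ∃ e : Fin (Module.finrank ℝ F) → Π x : M, V x, (∀ a, IsSmoothSection n F (e a)) ∧
      ∀ᶠ x in nhds x₀, ∃ b : Module.Basis (Fin (Module.finrank ℝ F)) ℝ (V x),
        ∀ a, b a = e a x := by
  set t := trivializationAt F V x₀
  have hx₀ : t.baseSet ∈ nhds x₀ := t.open_baseSet.mem_nhds (mem_baseSet_trivializationAt F V x₀)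
  obtain ⟨φ, -, hφ⟩ :=
    (SmoothBumpFunction.nhds_basis_tsupport (I := 𝓡 n) x₀).mem_iff.1 hx₀
  set b := Module.finBasis ℝ F
  -- The bump function extends the local frame by zero to global sections, and equals `1` near `x₀`,
  -- so nothing changes there.
  refine ⟨fun a ↦ ⇑φ • t.localFrame b a, fun a ↦ ?_, ?_⟩
  · exact ContMDiffOn.smul_section_of_tsupport φ.contMDiff.contMDiffOn t.open_baseSet hφ
      (t.contMDiffOn_localFrame_baseSet ∞ b a)
  · filter_upwards [φ.eventuallyEq_one, hx₀] with x hx hxt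
    refine ⟨t.basisAt b hxt, fun a ↦ ?_⟩
    simp [hx, hxt]

omit [∀ x, InnerProductSpace ℝ (V x)] [IsManifold (𝓡 n) ∞ M] in
lemma IsSmoothVariation.isSmoothSection {σ : Π x : M, V x} {s : ℝ → Π x : M, V x}
    (hs : IsSmoothVariation n F σ s) (t : ℝ) : IsSmoothSection n F (s t) :=
  hs.contMDiff.comp (contMDiff_id.prodMk contMDiff_const)

omit [∀ x, InnerProductSpace ℝ (V x)] in
lemma IsSmoothVariation.contMDiffOn_coord {σ : Π x : M, V x} {s : ℝ → Π x : M, V x}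
    (hs : IsSmoothVariation n F σ s) (x₀ : M) :
    ContMDiffOn 𝓘(ℝ, EuclideanSpace ℝ (Fin n) × ℝ) ((𝓡 n).prod 𝓘(ℝ, F)) ∞
      (fun z : EuclideanSpace ℝ (Fin n) × ℝ ↦ (⟨(extChartAt (𝓡 n) x₀).symm z.1,
        s z.2 ((extChartAt (𝓡 n) x₀).symm z.1)⟩ : TotalSpace F V))
      ((extChartAt (𝓡 n) x₀).target ×ˢ Set.univ) := by
  have h1 : ContMDiffOn 𝓘(ℝ, EuclideanSpace ℝ (Fin n) × ℝ) (𝓡 n) ∞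
      (fun z : EuclideanSpace ℝ (Fin n) × ℝ ↦ (extChartAt (𝓡 n) x₀).symm z.1)
      ((extChartAt (𝓡 n) x₀).target ×ˢ Set.univ) :=
    (contMDiffOn_extChartAt_symm x₀).comp contDiff_fst.contMDiff.contMDiffOn fun z hz ↦ hz.1
  exact hs.contMDiff.comp_contMDiffOn (h1.prodMk contDiff_snd.contMDiff.contMDiffOn)

omit [∀ x, InnerProductSpace ℝ (V x)] [IsManifold (𝓡 n) ∞ M] in
lemma contMDiffOn_comp_fst {x₀ : M} {v : ∀ y, V ((extChartAt (𝓡 n) x₀).symm y)}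
    (hv : ContMDiffOn (𝓡 n) ((𝓡 n).prod 𝓘(ℝ, F)) ∞
      (fun y ↦ (⟨(extChartAt (𝓡 n) x₀).symm y, v y⟩ : TotalSpace F V))
      (extChartAt (𝓡 n) x₀).target) :
    ContMDiffOn 𝓘(ℝ, EuclideanSpace ℝ (Fin n) × ℝ) ((𝓡 n).prod 𝓘(ℝ, F)) ∞
      (fun z : EuclideanSpace ℝ (Fin n) × ℝ ↦
        (⟨(extChartAt (𝓡 n) x₀).symm z.1, v z.1⟩ : TotalSpace F V))
      ((extChartAt (𝓡 n) x₀).target ×ˢ Set.univ) :=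
  hv.comp contDiff_fst.contMDiff.contMDiffOn fun _ hz ↦ hz.1

variable [VectorBundle ℝ F V] [FiniteDimensional ℝ F] [ContMDiffVectorBundle ∞ F V (𝓡 n)]
  [IsContMDiffRiemannianBundle (𝓡 n) ∞ F V]

open Filter Topology Asymptotics

/-- The product of `∇_i s_t` with a fixed smooth section is `O(t)` if `s_0` is parallel. -/
lemma isBigO_inner_covCoord_section {cov : CovariantDerivative (𝓡 n) F V}
    (hsmooth : cov.ContMDiffCovariantDerivative ∞) (hmetric : cov.IsMetricCompatible)
    {σ τ : Π x : M, V x} {s : ℝ → Π x : M, V x} (hs : IsSmoothVariation n F σ s)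
    (hσ : IsParallelSection cov σ) (hτ : IsSmoothSection n F τ) (x₀ : M)
    {y₀ : EuclideanSpace ℝ (Fin n)} (hy₀ : y₀ ∈ (extChartAt (𝓡 n) x₀).target) (i : Fin n) :
    (fun z : EuclideanSpace ℝ (Fin n) × ℝ ↦ (inner ℝ (covCoord cov (s z.2) x₀ i z.1)
      (τ ((extChartAt (𝓡 n) x₀).symm z.1)) : ℝ)) =O[𝓝 (y₀, 0)] fun z ↦ z.2 := by
  set T := (extChartAt (𝓡 n) x₀).target
  have hT : IsOpen T := isOpen_extChartAt_target x₀
  have hTo : IsOpen (T ×ˢ (Set.univ : Set ℝ)) := hT.prod isOpen_univ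
  set c : EuclideanSpace ℝ (Fin n) × ℝ → ℝ := fun z ↦
    inner ℝ (s z.2 ((extChartAt (𝓡 n) x₀).symm z.1)) (τ ((extChartAt (𝓡 n) x₀).symm z.1)) with hc
  have hcs : ContDiffOn ℝ ∞ c (T ×ˢ Set.univ) := by
    rw [← contMDiffOn_iff_contDiffOn]
    exact (hs.contMDiffOn_coord x₀).inner_bundle
      (contMDiffOn_comp_fst (contMDiffOn_section_comp_symm hτ x₀))
  have hds : ContDiffOn ℝ ∞ (fun z : EuclideanSpace ℝ (Fin n) × ℝ ↦ (inner ℝ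
      (s z.2 ((extChartAt (𝓡 n) x₀).symm z.1)) (covCoord cov τ x₀ i z.1) : ℝ))
      (T ×ˢ Set.univ) := by
    rw [← contMDiffOn_iff_contDiffOn]
    exact (hs.contMDiffOn_coord x₀).inner_bundle
      (contMDiffOn_comp_fst (contMDiffOn_covCoord hsmooth hτ x₀ i))
  -- Metric compatibility moves the derivative onto a scalar function and onto `τ`. This gives joint
  -- smoothness in `(y, t)` without regarding `∇ s_t` as a section depending on a parameter.
  have heq : ∀ z ∈ T ×ˢ (Set.univ : Set ℝ), (inner ℝ (covCoord cov (s z.2) x₀ i z.1)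
      (τ ((extChartAt (𝓡 n) x₀).symm z.1)) : ℝ) =
      fderiv ℝ c z (EuclideanSpace.single i (1 : ℝ), 0) - inner ℝ
        (s z.2 ((extChartAt (𝓡 n) x₀).symm z.1)) (covCoord cov τ x₀ i z.1) := fun z hz ↦ by
    rw [eq_sub_iff_add_eq, ← fderiv_inner_section hmetric (hs.isSmoothSection z.2) hτ x₀ hz.1 i,
      ← fderiv_slice (y := z.1) (t := z.2)
        ((hcs.contDiffAt (hTo.mem_nhds hz)).differentiableAt (by simp))]
    rfl
  have hmem : (y₀, (0 : ℝ)) ∈ T ×ˢ (Set.univ : Set ℝ) := ⟨hy₀, trivial⟩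
  refine isBigO_snd_of_contDiffAt ?_ ?_
  · refine ContDiffAt.congr_of_eventuallyEq ?_
      (Filter.eventuallyEq_of_mem (hTo.mem_nhds hmem) heq)
    refine ContDiffAt.sub ?_ ((hds.contDiffAt (hTo.mem_nhds hmem)).of_le (by simp))
    exact (((hcs.contDiffAt (hTo.mem_nhds hmem)).fderiv_right (m := ∞)
      (by simp)).clm_apply contDiffAt_const).of_le (by simp)
  · refine Filter.Eventually.of_forall fun y ↦ ?_
    change inner ℝ (cov (s 0) _ (coordVector x₀ i y)) _ = 0
    rw [hs.zero, hσ]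
    exact inner_zero_left _

/-- `⟨∇_i s_t, s_t⟩` is `O(t)` if `s_0` is parallel. -/
lemma isBigO_inner_covCoord_self {cov : CovariantDerivative (𝓡 n) F V}
    (hmetric : cov.IsMetricCompatible)
    {σ : Π x : M, V x} {s : ℝ → Π x : M, V x} (hs : IsSmoothVariation n F σ s)
    (hσ : IsParallelSection cov σ) (x₀ : M)
    {y₀ : EuclideanSpace ℝ (Fin n)} (hy₀ : y₀ ∈ (extChartAt (𝓡 n) x₀).target) (i : Fin n) :
    (fun z : EuclideanSpace ℝ (Fin n) × ℝ ↦ (inner ℝ (covCoord cov (s z.2) x₀ i z.1)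
      (s z.2 ((extChartAt (𝓡 n) x₀).symm z.1)) : ℝ)) =O[𝓝 (y₀, 0)] fun z ↦ z.2 := by
  set T := (extChartAt (𝓡 n) x₀).target
  have hT : IsOpen T := isOpen_extChartAt_target x₀
  have hTo : IsOpen (T ×ˢ (Set.univ : Set ℝ)) := hT.prod isOpen_univ
  set c : EuclideanSpace ℝ (Fin n) × ℝ → ℝ := fun z ↦
    inner ℝ (s z.2 ((extChartAt (𝓡 n) x₀).symm z.1)) (s z.2 ((extChartAt (𝓡 n) x₀).symm z.1))
  have hcs : ContDiffOn ℝ ∞ c (T ×ˢ Set.univ) := by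
    rw [← contMDiffOn_iff_contDiffOn]
    exact (hs.contMDiffOn_coord x₀).inner_bundle (hs.contMDiffOn_coord x₀)
  -- Here the product is half a derivative of `|s_t|²`, again a smooth scalar function of `(y, t)`.
  have heq : ∀ z ∈ T ×ˢ (Set.univ : Set ℝ), (inner ℝ (covCoord cov (s z.2) x₀ i z.1)
      (s z.2 ((extChartAt (𝓡 n) x₀).symm z.1)) : ℝ) =
      (1 / 2) * fderiv ℝ c z (EuclideanSpace.single i (1 : ℝ), 0) := fun z hz ↦ by
    have h := fderiv_inner_section hmetric (hs.isSmoothSection z.2) (hs.isSmoothSection z.2)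
      x₀ hz.1 i
    change fderiv ℝ (fun x ↦ c (x, z.2)) z.1 _ = _ at h
    rw [real_inner_comm (covCoord cov (s z.2) x₀ i z.1)] at h
    rw [← fderiv_slice (y := z.1) (t := z.2)
        ((hcs.contDiffAt (hTo.mem_nhds hz)).differentiableAt (by simp))]
    linear_combination (-1 / 2 : ℝ) * h
  have hmem : (y₀, (0 : ℝ)) ∈ T ×ˢ (Set.univ : Set ℝ) := ⟨hy₀, trivial⟩
  refine isBigO_snd_of_contDiffAt ?_ ?_
  · refine ContDiffAt.congr_of_eventuallyEq ?_
      (Filter.eventuallyEq_of_mem (hTo.mem_nhds hmem) heq)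
    exact (contDiffAt_const.mul (((hcs.contDiffAt (hTo.mem_nhds hmem)).fderiv_right (m := ∞)
      (by simp)).clm_apply contDiffAt_const)).of_le (by simp)
  · refine Filter.Eventually.of_forall fun y ↦ ?_
    change inner ℝ (cov (s 0) _ (coordVector x₀ i y)) _ = 0
    rw [hs.zero, hσ]
    exact inner_zero_left _

/-- Parseval's identity in an orthonormal basis, rewritten by the trace formula for the form `⟨v,
·⟩⟨w, ·⟩`. -/
lemma inner_eq_sum_inv_gram {W ι : Type*} [NormedAddCommGroup W] [InnerProductSpace ℝ W]
    [Fintype ι] [DecidableEq ι] (b : Module.Basis ι ℝ W) (v w : W) :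
    inner ℝ v w = ∑ i, ∑ j, (Matrix.of fun i j ↦ (inner ℝ (b i) (b j) : ℝ))⁻¹ i j *
      (inner ℝ v (b i) * inner ℝ w (b j)) := by
  have : FiniteDimensional ℝ W := b.finiteDimensional_of_finite
  have h := sum_orthonormalBasis_eq_sum_inv_gram (stdOrthonormalBasis ℝ W) b
    (LinearMap.mk₂ ℝ (fun x y ↦ inner ℝ v x * inner ℝ w y)
      (fun _ _ _ ↦ by simp only [inner_add_right]; ring)
      (fun _ _ _ ↦ by simp only [real_inner_smul_right, smul_eq_mul]; ring)
      (fun _ _ _ ↦ by simp only [inner_add_right]; ring)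
      (fun _ _ _ ↦ by simp only [real_inner_smul_right, smul_eq_mul]; ring))
  simp only [LinearMap.mk₂_apply] at h
  rw [← h, ← (stdOrthonormalBasis ℝ W).sum_inner_mul_inner v w]
  exact Finset.sum_congr rfl fun k _ ↦ by rw [real_inner_comm w]

/-- Expanded in a smooth frame, the product is a sum of two factors `O(t)`, each a product of `∇
s_t` with a fixed section, times an entry of the inverse Gram matrix of the frame, which is bounded
near the centre of the chart. -/
lemma isBigO_inner_covCoord_covCoord [T2Space M] {cov : CovariantDerivative (𝓡 n) F V}
    (hsmooth : cov.ContMDiffCovariantDerivative ∞) (hmetric : cov.IsMetricCompatible)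
    {σ : Π x : M, V x} {s : ℝ → Π x : M, V x} (hs : IsSmoothVariation n F σ s)
    (hσ : IsParallelSection cov σ) (x₀ : M) (i j : Fin n) :
    (fun z : EuclideanSpace ℝ (Fin n) × ℝ ↦ (inner ℝ (covCoord cov (s z.2) x₀ i z.1)
      (covCoord cov (s z.2) x₀ j z.1) : ℝ)) =O[𝓝 (extChartAt (𝓡 n) x₀ x₀, 0)]
      fun z ↦ z.2 ^ 2 := by
  classical
  obtain ⟨e, he, hb⟩ := exists_smooth_frame (n := n) (F := F) (V := V) x₀
  set ψ := (extChartAt (𝓡 n) x₀).symm with hψ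
  set y₀ := extChartAt (𝓡 n) x₀ x₀ with hy₀
  have hy₀T : y₀ ∈ (extChartAt (𝓡 n) x₀).target := mem_extChartAt_target x₀
  have hψc : Tendsto ψ (𝓝 y₀) (𝓝 x₀) := by
    have h := (continuousOn_extChartAt_symm (I := 𝓡 n) x₀).continuousAt
      (extChartAt_target_mem_nhds x₀)
    rw [ContinuousAt, extChartAt_to_inv] at h
    exact h
  set H : EuclideanSpace ℝ (Fin n) → Matrix _ _ ℝ :=
    fun y ↦ Matrix.of fun a b ↦ (inner ℝ (e a (ψ y)) (e b (ψ y)) : ℝ) with hH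
  have hdet : ∀ᶠ y in 𝓝 y₀, (H y).det ≠ 0 := by
    filter_upwards [hψc.eventually hb] with y hy
    obtain ⟨b, hb⟩ := hy
    have : H y = Matrix.gram ℝ b := by
      ext a c
      rw [Matrix.gram_apply, hb, hb]
      rfl
    rw [this]
    exact (Matrix.posDef_gram_of_linearIndependent b.linearIndependent).det_pos.ne'
  obtain ⟨U, hU, hUo, hyU⟩ := mem_nhds_iff.1 (inter_mem hdet (extChartAt_target_mem_nhds x₀))
  have hHc : ∀ a b, ContinuousAt (fun y ↦ (H y)⁻¹ a b) y₀ := fun a b ↦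
    (contDiffOn_matrix_inv (k := ∞) (s := U) (fun a b ↦
      (contDiffOn_inner_of_contMDiffOn (contMDiffOn_section_comp_symm (he a) x₀)
        (contMDiffOn_section_comp_symm (he b) x₀)).mono fun y hy ↦ (hU hy).2)
      (fun y hy ↦ (hU hy).1) a b).continuousOn.continuousAt (hUo.mem_nhds hyU)
  have hfst : Tendsto Prod.fst (𝓝 (y₀, (0 : ℝ))) (𝓝 y₀) := continuous_fst.tendsto' _ _ rfl
  have hev : (fun z : EuclideanSpace ℝ (Fin n) × ℝ ↦ (inner ℝ (covCoord cov (s z.2) x₀ i z.1)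
      (covCoord cov (s z.2) x₀ j z.1) : ℝ)) =ᶠ[𝓝 (y₀, 0)] fun z ↦
      ∑ a, ∑ b, (H z.1)⁻¹ a b * (inner ℝ (covCoord cov (s z.2) x₀ i z.1) (e a (ψ z.1)) *
        inner ℝ (covCoord cov (s z.2) x₀ j z.1) (e b (ψ z.1))) := by
    filter_upwards [hfst.eventually (hψc.eventually hb)] with z hz
    obtain ⟨b, hb⟩ := hz
    rw [inner_eq_sum_inv_gram b]
    simp only [hb]
    rfl
  refine hev.trans_isBigO (IsBigO.fun_sum fun a _ ↦ IsBigO.fun_sum fun b _ ↦ ?_)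
  have h1 := ((hHc a b).tendsto.comp hfst).isBigO_one ℝ
  have h2 := (isBigO_inner_covCoord_section hsmooth hmetric hs hσ (he a) x₀ hy₀T i).mul
    (isBigO_inner_covCoord_section hsmooth hmetric hs hσ (he b) x₀ hy₀T j)
  exact (h1.mul h2).congr (fun _ ↦ rfl) fun z ↦ by ring

variable [RiemannianBundle (fun x : M ↦ TangentSpace (𝓡 n) x)]
  [IsContMDiffRiemannianBundle (𝓡 n) ∞ (EuclideanSpace ℝ (Fin n))
    (fun x : M ↦ TangentSpace (𝓡 n) x)]

lemma isBigO_verticalEnergyDensity [T2Space M] {cov : CovariantDerivative (𝓡 n) F V}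
    (hsmooth : cov.ContMDiffCovariantDerivative ∞) (hmetric : cov.IsMetricCompatible)
    {σ : Π x : M, V x} {s : ℝ → Π x : M, V x} (hs : IsSmoothVariation n F σ s)
    (hσ : IsParallelSection cov σ) {p : ℝ} (hp : 0 ≤ p) (q : ℝ) (x₀ : M) :
    (fun z : M × ℝ ↦ verticalEnergyDensity cov p q (s z.2) z.1) =O[𝓝 (x₀, 0)]
      fun z ↦ z.2 ^ 2 := by
  set ψ := (extChartAt (𝓡 n) x₀).symm with hψ
  set y₀ := extChartAt (𝓡 n) x₀ x₀ with hy₀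
  have hy₀T : y₀ ∈ (extChartAt (𝓡 n) x₀).target := mem_extChartAt_target x₀
  have hfst : Tendsto Prod.fst (𝓝 (y₀, (0 : ℝ))) (𝓝 y₀) := continuous_fst.tendsto' _ _ rfl
  have hcoord : (fun z : EuclideanSpace ℝ (Fin n) × ℝ ↦
      verticalEnergyDensity cov p q (s z.2) (ψ z.1)) =O[𝓝 (y₀, 0)] fun z ↦ z.2 ^ 2 := by
    have hev : (fun z : EuclideanSpace ℝ (Fin n) × ℝ ↦
        verticalEnergyDensity cov p q (s z.2) (ψ z.1)) =ᶠ[𝓝 (y₀, 0)] fun z ↦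
        ∑ i, ∑ j, (gramMatrix x₀ z.1)⁻¹ i j * verticalMetric p q (s z.2 (ψ z.1))
          (covCoord cov (s z.2) x₀ i z.1) (covCoord cov (s z.2) x₀ j z.1) := by
      filter_upwards [hfst.eventually (extChartAt_target_mem_nhds x₀)] with z hz
      exact verticalEnergyDensity_eq_sum_coord cov p q (s z.2) x₀ hz
    refine hev.trans_isBigO (IsBigO.fun_sum fun i _ ↦ IsBigO.fun_sum fun j _ ↦ ?_)
    have h1 := (((contDiffOn_gramMatrix_inv x₀ i j).continuousOn.continuousAt
      (extChartAt_target_mem_nhds x₀)).tendsto.comp hfst).isBigO_one ℝ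
    -- The weight lies in `[0, 1]` because `p ≥ 0`, so it needs no regularity.
    have h2 : (fun z : EuclideanSpace ℝ (Fin n) × ℝ ↦ (1 / (1 + ‖s z.2 (ψ z.1)‖ ^ 2)) ^ p)
        =O[𝓝 (y₀, 0)] fun _ ↦ (1 : ℝ) := by
      refine IsBigO.of_bound 1 (Eventually.of_forall fun z ↦ ?_)
      have h0 : (0 : ℝ) ≤ 1 / (1 + ‖s z.2 (ψ z.1)‖ ^ 2) := by positivity
      have h1 : 1 / (1 + ‖s z.2 (ψ z.1)‖ ^ 2) ≤ 1 :=
        div_le_one_of_le₀ (by nlinarith [sq_nonneg ‖s z.2 (ψ z.1)‖]) (by positivity)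
      rw [Real.norm_of_nonneg (Real.rpow_nonneg h0 p)]
      simpa using Real.rpow_le_one h0 h1 hp
    have h3 := isBigO_inner_covCoord_covCoord hsmooth hmetric hs hσ x₀ i j
    have h4 := ((isBigO_inner_covCoord_self hmetric hs hσ x₀ hy₀T i).const_mul_left q).mul
      (isBigO_inner_covCoord_self hmetric hs hσ x₀ hy₀T j)
    simp only [← sq] at h4
    exact (h1.mul (h2.mul (h3.add h4))).congr (fun _ ↦ rfl) fun z ↦ by ring
  have hlim : Tendsto (fun z : M × ℝ ↦ (extChartAt (𝓡 n) x₀ z.1, z.2)) (𝓝 (x₀, 0))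
      (𝓝 (y₀, 0)) := by
    rw [nhds_prod_eq, nhds_prod_eq]
    exact (continuousAt_extChartAt x₀).tendsto.prodMap tendsto_id
  refine EventuallyEq.trans_isBigO ?_ (hcoord.comp_tendsto hlim)
  filter_upwards [(continuous_fst.tendsto' (x₀, (0 : ℝ)) x₀ rfl).eventually
    (extChartAt_source_mem_nhds (I := 𝓡 n) x₀)] with z hz
  simp only [Function.comp_apply]
  rw [hψ, (extChartAt (𝓡 n) x₀).left_inv hz]

lemma IsParallelSection.isPQHarmonic [T2Space M] [MeasurableSpace M] [BorelSpace M]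
    {cov : CovariantDerivative (𝓡 n) F V}
    (hsmooth : cov.ContMDiffCovariantDerivative ∞) (hmetric : cov.IsMetricCompatible)
    {σ : Π x : M, V x} (hσ : IsParallelSection cov σ) {p : ℝ} (hp : 0 ≤ p) (q : ℝ) :
    IsPQHarmonic cov p q σ := by
  intro K s hK hs _
  -- The local `O(t²)` bounds become uniform by compactness: such a bound passes to subsets and to
  -- finite unions.
  obtain ⟨C, hC⟩ : ∃ C : ℝ, ∀ᶠ t in 𝓝 (0 : ℝ), ∀ x ∈ K,
      ‖verticalEnergyDensity cov p q (s t) x‖ ≤ C * t ^ 2 := by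
    refine hK.induction_on (p := fun A ↦ ∃ C : ℝ, ∀ᶠ t in 𝓝 (0 : ℝ), ∀ x ∈ A,
      ‖verticalEnergyDensity cov p q (s t) x‖ ≤ C * t ^ 2) ⟨0, by simp⟩ ?_ ?_ ?_
    · rintro A B hAB ⟨C, hC⟩
      exact ⟨C, hC.mono fun t ht x hx ↦ ht x (hAB hx)⟩
    · rintro A B ⟨C, hC⟩ ⟨C', hC'⟩
      refine ⟨max C C', ?_⟩
      filter_upwards [hC, hC'] with t h h' x hx
      rcases hx with hx | hx
      · exact (h x hx).trans (mul_le_mul_of_nonneg_right (le_max_left _ _) (sq_nonneg t))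
      · exact (h' x hx).trans (mul_le_mul_of_nonneg_right (le_max_right _ _) (sq_nonneg t))
    · intro x _
      obtain ⟨C, hC⟩ := (isBigO_verticalEnergyDensity hsmooth hmetric hs hσ hp q x).bound
      rw [nhds_prod_eq, eventually_prod_iff] at hC
      obtain ⟨pa, ha, pb, hb, h⟩ := hC
      refine ⟨{x | pa x}, mem_nhdsWithin_of_mem_nhds ha, C, ?_⟩
      filter_upwards [hb] with t ht x' hx'
      simpa using h hx' ht
  have hE : (fun t ↦ verticalEnergyOn cov p q K (s t)) =O[𝓝 0] fun t : ℝ ↦ t ^ 2 := by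
    refine IsBigO.of_bound (1 / 2 * (C * (riemannianVolume n M).real K)) ?_
    filter_upwards [hC] with t ht
    rw [verticalEnergyOn, norm_mul, Real.norm_of_nonneg (by norm_num : (0 : ℝ) ≤ 1 / 2),
      Real.norm_of_nonneg (sq_nonneg t)]
    have := norm_setIntegral_le_of_norm_le_const
      (riemannianVolume_lt_top_of_isCompact (n := n) hK) ht
    calc _ ≤ 1 / 2 * (C * t ^ 2 * (riemannianVolume n M).real K) := by gcongr
      _ = _ := by ring
  -- The `O(t²)` bound, read at `t = 0` itself.
  have h0 : verticalEnergyOn cov p q K (s 0) = 0 := by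
    rcases hE.bound with ⟨C', hC'⟩
    have := hC'.self_of_nhds
    simpa using this
  rw [hasDerivAt_iff_isLittleO]
  simp only [h0, sub_zero, smul_zero]
  exact hE.trans_isLittleO (isLittleO_pow_id one_lt_two)

end Variation

/-! ### Calculus: differentiating integrals, the scaled energy density, integration by parts -/

section Analysis

/-- Dominated differentiation: the derivative is jointly continuous, hence bounded on the compact
set of pairs with `|t - t₀| ≤ 1` and `y ∈ K`. -/
lemma hasDerivAt_setIntegral_of_continuousOn {E : Type*} [TopologicalSpace E] [T2Space E]
    [MeasurableSpace E] [BorelSpace E] {μ : Measure E} [IsFiniteMeasureOnCompacts μ] {K : Set E}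
    (hK : IsCompact K) {Θ Θ' : ℝ → E → ℝ} (hΘ : ∀ t, ContinuousOn (Θ t) K)
    (hd : ∀ t, ∀ y ∈ K, HasDerivAt (fun t ↦ Θ t y) (Θ' t y) t)
    (hΘ' : ContinuousOn (Function.uncurry Θ') (Set.univ ×ˢ K)) (t₀ : ℝ) :
    HasDerivAt (fun t ↦ ∫ y in K, Θ t y ∂μ) (∫ y in K, Θ' t₀ y ∂μ) t₀ := by
  obtain ⟨C, hC⟩ := ((isCompact_closedBall t₀ 1).prod hK).exists_bound_of_continuousOn
    (hΘ'.mono (Set.prod_mono (Set.subset_univ _) le_rfl))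
  have hΘ'₀ : ContinuousOn (Θ' t₀) K :=
    hΘ'.comp (f := fun y ↦ (t₀, y)) (by fun_prop) fun y hy ↦ ⟨trivial, hy⟩
  refine (hasDerivAt_integral_of_dominated_loc_of_deriv_le (bound := fun _ ↦ C)
    (Metric.closedBall_mem_nhds t₀ one_pos)
    (Filter.Eventually.of_forall fun t ↦ ((hΘ t).integrableOn_compact hK).aestronglyMeasurable)
    ((hΘ t₀).integrableOn_compact hK)
    (hΘ'₀.integrableOn_compact hK).aestronglyMeasurable ?_ ?_ ?_).2
  · filter_upwards [ae_restrict_mem hK.measurableSet] with y hy t ht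
    exact hC (t, y) ⟨ht, hy⟩
  · exact integrableOn_const hK.measure_lt_top.ne
  · filter_upwards [ae_restrict_mem hK.measurableSet] with y hy t _
    exact hd t y hy

/-- The energy density of `(1 + t φ) σ` as a function of `t`. -/
def scalingProfile (p q φ u P Q R S t : ℝ) : ℝ :=
  (1 + (1 + t * φ) ^ 2 * u) ^ (-p) *
    ((1 + t * φ) ^ 2 * P + 2 * (1 + t * φ) * t * R + t ^ 2 * S * u +
      q * ((1 + t * φ) ^ 4 * Q + 2 * (1 + t * φ) ^ 3 * t * u * R +
        (1 + t * φ) ^ 2 * t ^ 2 * u ^ 2 * S))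

/-- The derivative of `scalingProfile` in `t`. -/
def scalingProfileDeriv (p q φ u P Q R S t : ℝ) : ℝ :=
  2 * (1 + t * φ) * φ * u * (-p) * (1 + (1 + t * φ) ^ 2 * u) ^ (-p - 1) *
    ((1 + t * φ) ^ 2 * P + 2 * (1 + t * φ) * t * R + t ^ 2 * S * u +
      q * ((1 + t * φ) ^ 4 * Q + 2 * (1 + t * φ) ^ 3 * t * u * R +
        (1 + t * φ) ^ 2 * t ^ 2 * u ^ 2 * S)) +
  (1 + (1 + t * φ) ^ 2 * u) ^ (-p) *
    (2 * (1 + t * φ) * φ * P + 2 * (φ * t + (1 + t * φ)) * R + 2 * t * S * u +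
      q * (4 * (1 + t * φ) ^ 3 * φ * Q +
        2 * (3 * (1 + t * φ) ^ 2 * φ * t + (1 + t * φ) ^ 3) * u * R +
        (2 * (1 + t * φ) * φ * t ^ 2 + (1 + t * φ) ^ 2 * (2 * t)) * u ^ 2 * S))

lemma hasDerivAt_scalingProfile (p q φ : ℝ) {u : ℝ} (hu : 0 ≤ u) (P Q R S t : ℝ) :
    HasDerivAt (scalingProfile p q φ u P Q R S) (scalingProfileDeriv p q φ u P Q R S t) t := by
  have hm : HasDerivAt (fun t : ℝ ↦ 1 + t * φ) φ t := by
    simpa using ((hasDerivAt_id t).mul_const φ).const_add 1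
  have ht : HasDerivAt (fun t : ℝ ↦ t) 1 t := hasDerivAt_id t
  have hpos : (0 : ℝ) < 1 + (1 + t * φ) ^ 2 * u := by positivity
  have hW := (((hm.fun_pow 2).mul_const u).const_add 1).rpow_const (p := -p) (Or.inl hpos.ne')
  have hB := ((((hm.fun_pow 2).mul_const P).add (((hm.const_mul 2).mul ht).mul_const R)).add
    (((ht.fun_pow 2).mul_const S).mul_const u)).add
    (((((hm.fun_pow 4).mul_const Q).add
      (((((hm.fun_pow 3).const_mul 2).mul ht).mul_const u).mul_const R)).add
      ((((hm.fun_pow 2).mul (ht.fun_pow 2)).mul_const (u ^ 2)).mul_const S)).const_mul q)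
  refine (hW.mul hB).congr_deriv ?_
  simp only [scalingProfileDeriv, Pi.add_apply, Pi.mul_apply]
  push_cast
  ring

/-- The term `S = |∇φ|²` enters with a factor `t²` and drops out; `∇φ` survives only through `R`,
with coefficient `2 (1 + u)^(-p) (1 + qu)`. -/
lemma scalingProfileDeriv_zero (p q φ u P Q R S : ℝ) :
    scalingProfileDeriv p q φ u P Q R S 0 =
      -2 * p * φ * u * (1 + u) ^ (-p - 1) * (P + q * Q) +
      (1 + u) ^ (-p) * (2 * φ * P + 2 * R + q * (4 * φ * Q + 2 * u * R)) := by
  simp only [scalingProfileDeriv, zero_mul, add_zero, one_pow, one_mul, mul_zero]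
  ring

lemma continuousOn_scalingProfile {E : Type*} [TopologicalSpace E] {K : Set E} (p q : ℝ)
    {φ u P Q R S : E → ℝ} (hφ : ContinuousOn φ K) (hu : ContinuousOn u K) (hP : ContinuousOn P K)
    (hQ : ContinuousOn Q K) (hR : ContinuousOn R K) (hS : ContinuousOn S K)
    (hu0 : ∀ y, 0 ≤ u y) (t : ℝ) :
    ContinuousOn (fun y ↦ scalingProfile p q (φ y) (u y) (P y) (Q y) (R y) (S y) t) K := by
  have hW : ContinuousOn (fun y ↦ (1 + (1 + t * φ y) ^ 2 * u y) ^ (-p)) K :=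
    ContinuousOn.rpow_const (by fun_prop) fun y _ ↦
      Or.inl (by have := hu0 y; positivity)
  unfold scalingProfile
  fun_prop

lemma continuousOn_scalingProfileDeriv {E : Type*} [TopologicalSpace E] {K : Set E} (p q : ℝ)
    {φ u P Q R S : E → ℝ} (hφ : ContinuousOn φ K) (hu : ContinuousOn u K) (hP : ContinuousOn P K)
    (hQ : ContinuousOn Q K) (hR : ContinuousOn R K) (hS : ContinuousOn S K)
    (hu0 : ∀ y, 0 ≤ u y) :
    ContinuousOn (fun z : ℝ × E ↦ scalingProfileDeriv p q (φ z.2) (u z.2) (P z.2) (Q z.2) (R z.2)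
      (S z.2) z.1) (Set.univ ×ˢ K) := by
  have hlift : ∀ {f : E → ℝ}, ContinuousOn f K →
      ContinuousOn (fun z : ℝ × E ↦ f z.2) (Set.univ ×ˢ K) := fun hf ↦
    hf.comp continuousOn_snd fun z hz ↦ hz.2
  have hφ := hlift hφ
  have hu := hlift hu
  have hP := hlift hP
  have hQ := hlift hQ
  have hR := hlift hR
  have hS := hlift hS
  have hW : ∀ r : ℝ, ContinuousOn (fun z : ℝ × E ↦ (1 + (1 + z.1 * φ z.2) ^ 2 * u z.2) ^ r)
      (Set.univ ×ˢ K) := fun r ↦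
    ContinuousOn.rpow_const (by fun_prop) fun z _ ↦
      Or.inl (by have := hu0 z.2; positivity)
  have hW1 := hW (-p)
  have hW2 := hW (-p - 1)
  unfold scalingProfileDeriv
  fun_prop

variable {E : Type*} [NormedAddCommGroup E] [NormedSpace ℝ E] [FiniteDimensional ℝ E]
  [MeasurableSpace E] [BorelSpace E] {μ : Measure E} [μ.IsAddHaarMeasure]

-- Coordinate expressions are controlled only on the chart target `T`; multiplication by a cutoff
-- supported in `T` makes them continuous everywhere.
omit [NormedSpace ℝ E] [FiniteDimensional ℝ E] [MeasurableSpace E] [BorelSpace E] in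
lemma continuous_mul_of_tsupport_subset {T : Set E} (hT : IsOpen T) {g φ : E → ℝ}
    (hg : ContinuousOn g T) (hφ : Continuous φ) (hφT : tsupport φ ⊆ T) :
    Continuous fun y ↦ g y * φ y :=
  ContinuousOn.continuous_of_tsupport_subset (s := T) (hg.mul hφ.continuousOn) hT
    ((tsupport_mul_subset_right (f := g) (g := φ)).trans hφT)

omit [NormedSpace ℝ E] [FiniteDimensional ℝ E] in
lemma integrable_mul_of_tsupport_subset {T : Set E} (hT : IsOpen T) {g φ : E → ℝ}
    (hg : ContinuousOn g T) (hφ : Continuous φ) (hφc : HasCompactSupport φ)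
    (hφT : tsupport φ ⊆ T) : Integrable (fun y ↦ g y * φ y) μ :=
  (continuous_mul_of_tsupport_subset hT hg hφ hφT).integrable_of_hasCompactSupport
    (hφc.mul_left (f := g))

/-- Integration by parts against a divergence free vector field `Y` defined on an open set. -/
lemma integral_mul_sum_fderiv_of_div_eq_zero {ι : Type*} [Fintype ι] {T : Set E} (hT : IsOpen T)
    (b : ι → E) {Y : ι → E → ℝ} {η φ : E → ℝ} (hY : ∀ i, ContDiffOn ℝ 1 (Y i) T)
    (hdiv : ∀ y ∈ T, ∑ i, fderiv ℝ (Y i) y (b i) = 0) (hη : ContDiffOn ℝ 1 η T)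
    (hφ : ContDiff ℝ 1 φ) (hφc : HasCompactSupport φ) (hφT : tsupport φ ⊆ T) :
    ∫ y, η y * ∑ i, Y i y * fderiv ℝ φ y (b i) ∂μ =
      -∫ y, (∑ i, fderiv ℝ η y (b i) * Y i y) * φ y ∂μ := by
  have hηY : ∀ i, ContDiffOn ℝ 1 (fun y ↦ η y * Y i y) T := fun i ↦ hη.mul (hY i)
  have hdφ : ∀ v, Continuous fun y ↦ fderiv ℝ φ y v := fun v ↦
    (hφ.continuous_fderiv one_ne_zero).clm_apply continuous_const
  have hdφs : ∀ v, tsupport (fun y ↦ fderiv ℝ φ y v) ⊆ tsupport φ := fun v ↦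
    tsupport_fderiv_apply_subset ℝ v
  have hdηY : ∀ i, ContinuousOn (fun y ↦ fderiv ℝ (fun y ↦ η y * Y i y) y (b i)) T := fun i ↦
    ((hηY i).continuousOn_fderiv_of_isOpen hT le_rfl).clm_apply continuousOn_const
  have hI1 : ∀ i, Integrable (fun y ↦ (η y * Y i y) * fderiv ℝ φ y (b i)) μ := fun i ↦
    integrable_mul_of_tsupport_subset hT (hηY i).continuousOn (hdφ _)
      (hφc.fderiv_apply ℝ _) ((hdφs _).trans hφT)
  have hI2 : ∀ i, Integrable (fun y ↦ fderiv ℝ (fun y ↦ η y * Y i y) y (b i) * φ y) μ := fun i ↦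
    integrable_mul_of_tsupport_subset hT (hdηY i) hφ.continuous hφc hφT
  have hparts : ∀ i, ∫ y, (η y * Y i y) * fderiv ℝ φ y (b i) ∂μ =
      -∫ y, fderiv ℝ (fun y ↦ η y * Y i y) y (b i) * φ y ∂μ := fun i ↦
    integral_mul_fderiv_eq_neg_fderiv_mul_of_integrable (hI2 i) (hI1 i)
      (integrable_mul_of_tsupport_subset hT (hηY i).continuousOn hφ.continuous hφc hφT)
      (fun y hy ↦ ((hηY i).contDiffAt (hT.mem_nhds (hφT hy))).differentiableAt one_ne_zero)
      fun y _ ↦ (hφ.differentiable one_ne_zero) y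
  calc ∫ y, η y * ∑ i, Y i y * fderiv ℝ φ y (b i) ∂μ
      = ∑ i, ∫ y, (η y * Y i y) * fderiv ℝ φ y (b i) ∂μ := by
        rw [← integral_finsetSum _ fun i _ ↦ hI1 i]
        simp only [Finset.mul_sum, mul_assoc]
    _ = -∫ y, ∑ i, fderiv ℝ (fun y ↦ η y * Y i y) y (b i) * φ y ∂μ := by
        rw [integral_finsetSum _ fun i _ ↦ hI2 i, ← Finset.sum_neg_distrib]
        exact Finset.sum_congr rfl fun i _ ↦ hparts i
    _ = _ := by
        congr 1
        refine integral_congr_ae (Filter.Eventually.of_forall fun y ↦ ?_)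
        by_cases hy : y ∈ T
        · have hdη := ((hη.contDiffAt (hT.mem_nhds hy)).differentiableAt one_ne_zero)
          -- In the product rule the terms `η ∂_i Y_i` sum to `η` times the divergence, which is
          -- zero.
          have hprod : ∀ i, fderiv ℝ (fun y ↦ η y * Y i y) y (b i) =
              η y * fderiv ℝ (Y i) y (b i) + fderiv ℝ η y (b i) * Y i y := fun i ↦ by
            rw [fderiv_fun_mul hdη
              (((hY i).contDiffAt (hT.mem_nhds hy)).differentiableAt one_ne_zero)]
            simp [mul_comm]
          simp only [hprod, ← Finset.sum_mul]
          rw [Finset.sum_add_distrib, ← Finset.mul_sum, hdiv y hy, mul_zero, zero_add]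
        · have : φ y = 0 := image_eq_zero_of_notMem_tsupport fun h ↦ hy (hφT h)
          simp [this]

end Analysis

/-! ### Energy density of the scaled sections `(1 + tφ)σ` -/

section FirstVariation

variable {n : ℕ} {M : Type*} [TopologicalSpace M] [ChartedSpace (EuclideanSpace ℝ (Fin n)) M]
  [IsManifold (𝓡 n) ∞ M]
  {F : Type*} [NormedAddCommGroup F] [NormedSpace ℝ F]
  {V : M → Type*} [TopologicalSpace (TotalSpace F V)]
  [∀ x, NormedAddCommGroup (V x)] [∀ x, InnerProductSpace ℝ (V x)] [FiberBundle F V]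

omit [IsManifold (𝓡 n) ∞ M] in
/-- Scaling a section by `1 + t φ` is a smooth variation. -/
lemma isSmoothVariation_scaling [VectorBundle ℝ F V] {σ : Π x : M, V x}
    (hσ : IsSmoothSection n F σ) {φ : M → ℝ} (hφ : ContMDiff (𝓡 n) 𝓘(ℝ, ℝ) ∞ φ) :
    IsSmoothVariation n F σ fun t ↦ (fun x ↦ 1 + t * φ x) • σ where
  zero := by ext x; simp
  contMDiff := fun z₀ ↦ by
    have hs : ContMDiffAt ((𝓡 n).prod 𝓘(ℝ, ℝ)) ((𝓡 n).prod 𝓘(ℝ, F)) ∞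
        (fun z : M × ℝ ↦ (⟨z.1, σ z.1⟩ : TotalSpace F V)) z₀ :=
      (ContMDiff.comp hσ contMDiff_fst) z₀
    have hc : ContMDiffAt ((𝓡 n).prod 𝓘(ℝ, ℝ)) 𝓘(ℝ, ℝ) ∞
        (fun z : M × ℝ ↦ 1 + z.2 * φ z.1) z₀ :=
      (contMDiff_const.add (contMDiff_snd.mul (hφ.comp contMDiff_fst))) z₀
    -- Smoothness is checked in a trivialization, whose linearity on fibres turns the scaling into a
    -- product of smooth functions.
    rw [contMDiffAt_totalSpace] at hs ⊢
    refine ⟨hs.1, (hc.smul hs.2).congr_of_eventuallyEq ?_⟩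
    have hmem : ∀ᶠ z : M × ℝ in nhds z₀, z.1 ∈ (trivializationAt F V z₀.1).baseSet :=
      (continuous_fst.tendsto z₀).eventually ((trivializationAt F V z₀.1).open_baseSet.mem_nhds
        (mem_baseSet_trivializationAt F V z₀.1))
    filter_upwards [hmem] with z hz
    exact ((trivializationAt F V z₀.1).linear ℝ hz).2 _ _

/-- The energy density of a scaled section in terms of that of the section. -/
lemma verticalMetric_scaling {W : Type*} [NormedAddCommGroup W] [InnerProductSpace ℝ W]
    (p q m t a b : ℝ) (e A B : W) :
    verticalMetric p q (m • e) (m • A + (t * a) • e) (m • B + (t * b) • e) =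
      (1 + m ^ 2 * ‖e‖ ^ 2) ^ (-p) *
        ((m ^ 2 * inner ℝ A B + m * t * (a * inner ℝ B e + b * inner ℝ A e) +
          t ^ 2 * (a * b) * ‖e‖ ^ 2) +
        q * ((m ^ 2 * inner ℝ A e + m * t * a * ‖e‖ ^ 2) *
          (m ^ 2 * inner ℝ B e + m * t * b * ‖e‖ ^ 2))) := by
  have h : (1 / (1 + ‖m • e‖ ^ 2)) ^ p = (1 + m ^ 2 * ‖e‖ ^ 2) ^ (-p) := by
    rw [norm_smul, mul_pow, Real.norm_eq_abs, sq_abs, one_div, Real.inv_rpow (by positivity),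
      Real.rpow_neg (by positivity)]
  rw [verticalMetric, h]
  simp only [inner_add_left, inner_add_right, real_inner_smul_left, real_inner_smul_right,
    real_inner_self_eq_norm_sq, real_inner_comm B e]
  rw [real_inner_comm e B, real_inner_comm e A]
  ring

/-- Here `a` plays the role of `g^{ij}`, `g` of `dφ` and `f` of `⟨∇σ, σ⟩`. Symmetry of `a` merges
the two cross terms into a single `R`. -/
lemma sum_scaling_eq_scalingProfile {ι : Type*} [Fintype ι] {a : ι → ι → ℝ}
    (ha : ∀ i j, a i j = a j i) (A : ι → ι → ℝ) (f g : ι → ℝ) (p q t φ u : ℝ) :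
    ∑ i, ∑ j, a i j * ((1 + (1 + t * φ) ^ 2 * u) ^ (-p) *
      (((1 + t * φ) ^ 2 * A i j + (1 + t * φ) * t * (g i * f j + g j * f i) +
        t ^ 2 * (g i * g j) * u) +
      q * (((1 + t * φ) ^ 2 * f i + (1 + t * φ) * t * g i * u) *
        ((1 + t * φ) ^ 2 * f j + (1 + t * φ) * t * g j * u)))) =
      scalingProfile p q φ u (∑ i, ∑ j, a i j * A i j) (∑ i, ∑ j, a i j * (f i * f j))
        (∑ i, ∑ j, a i j * (g i * f j)) (∑ i, ∑ j, a i j * (g i * g j)) t := by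
  have hR : ∑ i, ∑ j, a i j * (g j * f i) = ∑ i, ∑ j, a i j * (g i * f j) := by
    rw [Finset.sum_comm]
    exact Finset.sum_congr rfl fun i _ ↦ Finset.sum_congr rfl fun j _ ↦ by rw [ha j i]
  rw [scalingProfile]
  set m := 1 + t * φ
  have key : ∀ i j, a i j * ((1 + m ^ 2 * u) ^ (-p) *
      ((m ^ 2 * A i j + m * t * (g i * f j + g j * f i) + t ^ 2 * (g i * g j) * u) +
      q * ((m ^ 2 * f i + m * t * g i * u) * (m ^ 2 * f j + m * t * g j * u)))) =
      (1 + m ^ 2 * u) ^ (-p) * (m ^ 2 * (a i j * A i j) +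
        (m * t + q * m ^ 3 * t * u) * (a i j * (g i * f j)) +
        (m * t + q * m ^ 3 * t * u) * (a i j * (g j * f i)) +
        (t ^ 2 * u + q * m ^ 2 * t ^ 2 * u ^ 2) * (a i j * (g i * g j)) +
        q * m ^ 4 * (a i j * (f i * f j))) := fun i j ↦ by ring
  simp only [key, ← Finset.mul_sum, Finset.sum_add_distrib]
  rw [hR]
  ring

/-- The quadratic form `∑ g^{ij} A_{ij}` of the chart around `x₀`. -/
def coordTrace [RiemannianBundle (fun x : M ↦ TangentSpace (𝓡 n) x)] (x₀ : M)
    (A : Fin n → Fin n → ℝ) (y : EuclideanSpace ℝ (Fin n)) : ℝ :=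
  ∑ i, ∑ j, (gramMatrix x₀ y)⁻¹ i j * A i j

section Trace

variable [RiemannianBundle (fun x : M ↦ TangentSpace (𝓡 n) x)]

omit [IsManifold (𝓡 n) ∞ M] in
lemma gramMatrix_inv_symm (x₀ : M) (y : EuclideanSpace ℝ (Fin n)) (i j : Fin n) :
    (gramMatrix x₀ y)⁻¹ i j = (gramMatrix x₀ y)⁻¹ j i := by
  have h : (gramMatrix x₀ y).transpose = gramMatrix x₀ y := by
    ext i j
    exact real_inner_comm (coordVector x₀ i y) (coordVector x₀ j y)
  conv_rhs => rw [← h, ← Matrix.transpose_nonsing_inv]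
  rfl

lemma coordTrace_mul_self_nonneg (x₀ : M) {y : EuclideanSpace ℝ (Fin n)}
    (hy : y ∈ (extChartAt (𝓡 n) x₀).target) (f : Fin n → ℝ) :
    0 ≤ coordTrace x₀ (fun i j ↦ f i * f j) y := by
  have h := (gramMatrix_posDef x₀ hy).inv.posSemidef.dotProduct_mulVec_nonneg f
  refine h.trans_eq (Finset.sum_congr rfl fun i _ ↦ ?_)
  refine (Finset.mul_sum Finset.univ (fun j ↦ (gramMatrix x₀ y)⁻¹ i j * f j) (f i)).trans
    (Finset.sum_congr rfl fun j _ ↦ ?_)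
  ring

lemma continuousOn_coordTrace [IsContMDiffRiemannianBundle (𝓡 n) ∞ (EuclideanSpace ℝ (Fin n))
      (fun x : M ↦ TangentSpace (𝓡 n) x)] (x₀ : M)
    {A : EuclideanSpace ℝ (Fin n) → Fin n → Fin n → ℝ}
    (hA : ∀ i j, ContinuousOn (fun y ↦ A y i j) (extChartAt (𝓡 n) x₀).target) :
    ContinuousOn (fun y ↦ coordTrace x₀ (A y) y) (extChartAt (𝓡 n) x₀).target :=
  continuousOn_finsetSum _ fun i _ ↦ continuousOn_finsetSum _ fun j _ ↦
    (contDiffOn_gramMatrix_inv x₀ i j).continuousOn.mul (hA i j)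

end Trace

variable [RiemannianBundle (fun x : M ↦ TangentSpace (𝓡 n) x)]

/-- By the Leibniz rule, `∇_i ((1 + tφ)σ) = (1 + tφ) ∇_i σ + t ∂_iφ σ`; the rest is algebra in the
fibre. -/
lemma verticalEnergyDensity_scaling (cov : CovariantDerivative (𝓡 n) F V) (p q : ℝ)
    {σ : Π x : M, V x} (hσ : IsSmoothSection n F σ) {φ : M → ℝ}
    (hφ : ContMDiff (𝓡 n) 𝓘(ℝ, ℝ) ∞ φ) (x₀ : M) {y : EuclideanSpace ℝ (Fin n)}
    (hy : y ∈ (extChartAt (𝓡 n) x₀).target) (t : ℝ)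
    {dφ f : Fin n → ℝ} (hdφ : ∀ i, fderiv ℝ (φ ∘ (extChartAt (𝓡 n) x₀).symm) y
      (EuclideanSpace.single i (1 : ℝ)) = dφ i)
    (hf : ∀ i, inner ℝ (covCoord cov σ x₀ i y) (σ ((extChartAt (𝓡 n) x₀).symm y)) = f i) :
    verticalEnergyDensity cov p q ((fun x ↦ 1 + t * φ x) • σ) ((extChartAt (𝓡 n) x₀).symm y) =
      scalingProfile p q (φ ((extChartAt (𝓡 n) x₀).symm y))
        (‖σ ((extChartAt (𝓡 n) x₀).symm y)‖ ^ 2)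
        (coordTrace x₀ (fun i j ↦ inner ℝ (covCoord cov σ x₀ i y) (covCoord cov σ x₀ j y)) y)
        (coordTrace x₀ (fun i j ↦ f i * f j) y) (coordTrace x₀ (fun i j ↦ dφ i * f j) y)
        (coordTrace x₀ (fun i j ↦ dφ i * dφ j) y) t := by
  have hφd : DifferentiableAt ℝ (φ ∘ (extChartAt (𝓡 n) x₀).symm) y := by
    rw [← mdifferentiableAt_iff_differentiableAt]
    exact MDifferentiableAt.comp y (I' := 𝓡 n) (hφ.mdifferentiableAt (by simp))
      (mdifferentiableAt_extChartAt_symm_of_mem x₀ hy)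
  have hcov : ∀ i, covCoord cov ((fun x ↦ 1 + t * φ x) • σ) x₀ i y =
      (1 + t * φ ((extChartAt (𝓡 n) x₀).symm y)) • covCoord cov σ x₀ i y +
        (t * dφ i) • σ ((extChartAt (𝓡 n) x₀).symm y) := fun i ↦ by
    have hg : ContMDiff (𝓡 n) 𝓘(ℝ, ℝ) ∞ fun x ↦ 1 + t * φ x :=
      contMDiff_const.add (contMDiff_const.mul hφ)
    have h := (hφd.hasFDerivAt.const_mul t).const_add 1
    have h' : HasFDerivAt ((fun x ↦ 1 + t * φ x) ∘ (extChartAt (𝓡 n) x₀).symm) _ y := h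
    rw [covCoord_smul cov x₀ hy hσ hg, h'.fderiv, ← hdφ i]
    rw [smul_apply, smul_eq_mul]
  rw [verticalEnergyDensity_eq_sum_coord cov p q _ x₀ hy]
  refine (Finset.sum_congr rfl fun i _ ↦ Finset.sum_congr rfl fun j _ ↦ ?_).trans
    (sum_scaling_eq_scalingProfile (gramMatrix_inv_symm x₀ y) _ f dφ p q t _ _)
  refine congrArg (fun r ↦ (gramMatrix x₀ y)⁻¹ i j * r) ?_
  rw [hcov, hcov, ← hf i, ← hf j]
  exact verticalMetric_scaling p q (1 + t * φ ((extChartAt (𝓡 n) x₀).symm y)) t (dφ i) (dφ j)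
    (σ ((extChartAt (𝓡 n) x₀).symm y)) (covCoord cov σ x₀ i y) (covCoord cov σ x₀ j y)

/-- For `p = q = 0` the energy density is the plain `|∇σ|²`; this form shows that the coordinate
trace is nonnegative and detects `∇σ = 0`. -/
lemma coordTrace_inner_covCoord (cov : CovariantDerivative (𝓡 n) F V) (σ : Π x : M, V x) (x₀ : M)
    {y : EuclideanSpace ℝ (Fin n)} (hy : y ∈ (extChartAt (𝓡 n) x₀).target) :
    coordTrace x₀ (fun i j ↦ inner ℝ (covCoord cov σ x₀ i y) (covCoord cov σ x₀ j y)) y =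
      verticalEnergyDensity cov 0 0 σ ((extChartAt (𝓡 n) x₀).symm y) := by
  rw [verticalEnergyDensity_eq_sum_coord cov 0 0 _ x₀ hy]
  simp [coordTrace, verticalMetric]

omit [IsManifold (𝓡 n) ∞ M] in
lemma verticalEnergyDensity_zero_zero_nonneg (cov : CovariantDerivative (𝓡 n) F V)
    (σ : Π x : M, V x) (x : M) : 0 ≤ verticalEnergyDensity cov 0 0 σ x := by
  refine Finset.sum_nonneg fun i _ ↦ ?_
  simp only [verticalMetric, Real.rpow_zero, one_mul, zero_mul, add_zero]
  exact real_inner_self_nonneg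

omit [IsManifold (𝓡 n) ∞ M] in
lemma cov_eq_zero_of_verticalEnergyDensity_zero_zero {cov : CovariantDerivative (𝓡 n) F V}
    {σ : Π x : M, V x} {x : M} (h : verticalEnergyDensity cov 0 0 σ x = 0) : cov σ x = 0 := by
  have hterm := (Finset.sum_eq_zero_iff_of_nonneg fun i _ ↦ by
    simp only [verticalMetric, Real.rpow_zero, one_mul, zero_mul, add_zero]
    exact real_inner_self_nonneg).1 h
  have hbasis : ∀ i, cov σ x (stdOrthonormalBasis ℝ (TangentSpace (𝓡 n) x) i) = 0 := fun i ↦ by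
    have := hterm i (Finset.mem_univ i)
    simpa [verticalMetric] using this
  refine ContinuousLinearMap.coe_injective
    ((stdOrthonormalBasis ℝ (TangentSpace (𝓡 n) x)).toBasis.ext fun i ↦ ?_)
  simpa using hbasis i

end FirstVariation

/-! ### First variation under scaling, in a chart -/

section Harmonic

variable {n : ℕ} {M : Type*} [TopologicalSpace M] [ChartedSpace (EuclideanSpace ℝ (Fin n)) M]

lemma SmoothBumpFunction.closedBall_subset_target {x₀ : M} (φ : SmoothBumpFunction (𝓡 n) x₀) :
    Metric.closedBall (extChartAt (𝓡 n) x₀ x₀) φ.rOut ⊆ (extChartAt (𝓡 n) x₀).target := by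
  have h := φ.closedBall_subset
  rwa [ModelWithCorners.range_eq_univ, Set.inter_univ] at h

lemma SmoothBumpFunction.apply_extChartAt_symm {x₀ : M} (φ : SmoothBumpFunction (𝓡 n) x₀)
    {y : EuclideanSpace ℝ (Fin n)} (hy : y ∈ (extChartAt (𝓡 n) x₀).target) :
    φ ((extChartAt (𝓡 n) x₀).symm y) = φ.toContDiffBump y := by
  have hs : (extChartAt (𝓡 n) x₀).symm y ∈ (chartAt (EuclideanSpace ℝ (Fin n)) x₀).source := by
    rw [← extChartAt_source (𝓡 n)]
    exact (extChartAt (𝓡 n) x₀).map_target hy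
  rw [φ.eqOn_source hs, Function.comp_apply, (extChartAt (𝓡 n) x₀).right_inv hy]

variable [IsManifold (𝓡 n) ∞ M]
  {F : Type*} [NormedAddCommGroup F] [NormedSpace ℝ F] [FiniteDimensional ℝ F]
  {V : M → Type*} [TopologicalSpace (TotalSpace F V)]
  [∀ x, NormedAddCommGroup (V x)] [∀ x, InnerProductSpace ℝ (V x)] [FiberBundle F V]
  [VectorBundle ℝ F V] [ContMDiffVectorBundle ∞ F V (𝓡 n)]
  [IsContMDiffRiemannianBundle (𝓡 n) ∞ F V]

omit [FiniteDimensional ℝ F] [ContMDiffVectorBundle ∞ F V (𝓡 n)] in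
lemma contDiffOn_normSq_section {σ : Π x : M, V x} (hσ : IsSmoothSection n F σ) (x₀ : M) :
    ContDiffOn ℝ ∞ (fun y ↦ ‖σ ((extChartAt (𝓡 n) x₀).symm y)‖ ^ 2)
      (extChartAt (𝓡 n) x₀).target :=
  (contDiffOn_inner_of_contMDiffOn (contMDiffOn_section_comp_symm hσ x₀)
    (contMDiffOn_section_comp_symm hσ x₀)).congr fun _ _ ↦ (real_inner_self_eq_norm_sq _).symm

lemma fderiv_normSq_section {cov : CovariantDerivative (𝓡 n) F V}
    (hmetric : cov.IsMetricCompatible) {σ : Π x : M, V x}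
    (hσ : IsSmoothSection n F σ) (x₀ : M)
    {y : EuclideanSpace ℝ (Fin n)} (hy : y ∈ (extChartAt (𝓡 n) x₀).target) (i : Fin n) :
    fderiv ℝ ((fun x ↦ ‖σ x‖ ^ 2) ∘ (extChartAt (𝓡 n) x₀).symm) y
        (EuclideanSpace.single i (1 : ℝ)) =
      2 * inner ℝ (covCoord cov σ x₀ i y) (σ ((extChartAt (𝓡 n) x₀).symm y)) := by
  have h := fderiv_inner_section hmetric hσ hσ x₀ hy i
  simp only [real_inner_self_eq_norm_sq] at h
  rw [h, real_inner_comm (covCoord cov σ x₀ i y)]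
  ring

variable [RiemannianBundle (fun x : M ↦ TangentSpace (𝓡 n) x)]
  [IsContMDiffRiemannianBundle (𝓡 n) ∞ (EuclideanSpace ℝ (Fin n))
    (fun x : M ↦ TangentSpace (𝓡 n) x)]

omit [FiniteDimensional ℝ F] [ContMDiffVectorBundle ∞ F V (𝓡 n)] in
/-- The first variation of a `(p,q)`-harmonic section under rescaling by a bump function. -/
lemma IsPQHarmonic.setIntegral_scalingProfileDeriv_eq_zero [T2Space M] [MeasurableSpace M]
    [BorelSpace M] {cov : CovariantDerivative (𝓡 n) F V}
    (hsmooth : cov.ContMDiffCovariantDerivative ∞) {p q : ℝ} {σ : Π x : M, V x}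
    (hσ : IsSmoothSection n F σ) (hharm : IsPQHarmonic cov p q σ) (x₀ : M)
    (φ : SmoothBumpFunction (𝓡 n) x₀) :
    ∫ y in Metric.closedBall (extChartAt (𝓡 n) x₀ x₀) φ.rOut, volumeDensity x₀ y *
      scalingProfileDeriv p q (φ.toContDiffBump y) (‖σ ((extChartAt (𝓡 n) x₀).symm y)‖ ^ 2)
        (coordTrace x₀ (fun i j ↦ inner ℝ (covCoord cov σ x₀ i y) (covCoord cov σ x₀ j y)) y)
        (coordTrace x₀ (fun i j ↦
          inner ℝ (covCoord cov σ x₀ i y) (σ ((extChartAt (𝓡 n) x₀).symm y)) *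
          inner ℝ (covCoord cov σ x₀ j y) (σ ((extChartAt (𝓡 n) x₀).symm y))) y)
        (coordTrace x₀ (fun i j ↦ fderiv ℝ φ.toContDiffBump y (EuclideanSpace.single i (1 : ℝ)) *
          inner ℝ (covCoord cov σ x₀ j y) (σ ((extChartAt (𝓡 n) x₀).symm y))) y)
        (coordTrace x₀ (fun i j ↦ fderiv ℝ φ.toContDiffBump y (EuclideanSpace.single i (1 : ℝ)) *
          fderiv ℝ φ.toContDiffBump y (EuclideanSpace.single j (1 : ℝ))) y) 0 = 0 := by
  have hT : IsOpen (extChartAt (𝓡 n) x₀).target := isOpen_extChartAt_target x₀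
  have hKT := φ.closedBall_subset_target
  have hK : IsCompact (Metric.closedBall (extChartAt (𝓡 n) x₀ x₀) φ.rOut) :=
    isCompact_closedBall _ _
  have hφ : ContMDiff (𝓡 n) 𝓘(ℝ, ℝ) ∞ φ := φ.contMDiff
  have hφc : ContinuousOn φ.toContDiffBump (extChartAt (𝓡 n) x₀).target :=
    φ.toContDiffBump.continuous.continuousOn
  have hdφc : ∀ i : Fin n, ContinuousOn
      (fun y ↦ fderiv ℝ φ.toContDiffBump y (EuclideanSpace.single i (1 : ℝ)))
      (extChartAt (𝓡 n) x₀).target := fun i ↦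
    (((φ.toContDiffBump.contDiff (n := 1)).continuous_fderiv one_ne_zero).clm_apply
      continuous_const).continuousOn
  have huc := (contDiffOn_normSq_section hσ x₀).continuousOn
  have hfc : ∀ i, ContinuousOn (fun y ↦ (inner ℝ (covCoord cov σ x₀ i y)
      (σ ((extChartAt (𝓡 n) x₀).symm y)) : ℝ)) (extChartAt (𝓡 n) x₀).target := fun i ↦
    (contDiffOn_inner_of_contMDiffOn (contMDiffOn_covCoord hsmooth hσ x₀ i)
      (contMDiffOn_section_comp_symm hσ x₀)).continuousOn
  have hPc := continuousOn_coordTrace (n := n) x₀ (A := fun y i j ↦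
    inner ℝ (covCoord cov σ x₀ i y) (covCoord cov σ x₀ j y)) fun i j ↦
    (contDiffOn_inner_of_contMDiffOn (contMDiffOn_covCoord hsmooth hσ x₀ i)
      (contMDiffOn_covCoord hsmooth hσ x₀ j)).continuousOn
  have hQc := continuousOn_coordTrace (n := n) x₀ fun i j ↦ (hfc i).fun_mul (hfc j)
  have hRc := continuousOn_coordTrace (n := n) x₀ fun i j ↦ (hdφc i).fun_mul (hfc j)
  have hSc := continuousOn_coordTrace (n := n) x₀ fun i j ↦ (hdφc i).fun_mul (hdφc j)
  have hDc := (contDiffOn_volumeDensity (n := n) x₀).continuousOn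
  have hdφ : ∀ y ∈ (extChartAt (𝓡 n) x₀).target, ∀ i,
      fderiv ℝ (φ ∘ (extChartAt (𝓡 n) x₀).symm) y (EuclideanSpace.single i (1 : ℝ)) =
      fderiv ℝ φ.toContDiffBump y (EuclideanSpace.single i (1 : ℝ)) := fun y hy i ↦ by
    have hev : φ ∘ (extChartAt (𝓡 n) x₀).symm =ᶠ[nhds y] φ.toContDiffBump :=
      Filter.eventuallyEq_of_mem (hT.mem_nhds hy) fun z hz ↦ φ.apply_extChartAt_symm hz
    rw [hev.fderiv_eq]
  have hdens : ∀ t, ∀ y ∈ (extChartAt (𝓡 n) x₀).target, verticalEnergyDensity cov p q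
      ((fun x ↦ 1 + t * φ x) • σ) ((extChartAt (𝓡 n) x₀).symm y) = _ := fun t y hy ↦
    verticalEnergyDensity_scaling cov p q hσ hφ x₀ hy t (hdφ y hy) fun i ↦ rfl
  -- The compact set is the image of the closed ball of radius `φ.rOut`: it contains the support of
  -- the bump, so the variation is fixed outside it.
  have hvar := hharm _ _ (hK.image_of_continuousOn
    ((continuousOn_extChartAt_symm x₀).mono hKT)) (isSmoothVariation_scaling hσ hφ) fun t x hx ↦ by
    have h0 : φ x = 0 := by
      refine image_eq_zero_of_notMem_tsupport fun h ↦ hx ?_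
      have h' := φ.tsupport_subset_symm_image_closedBall h
      rwa [ModelWithCorners.range_eq_univ, Set.inter_univ] at h'
    simp [h0]
  have hΘ := fun t ↦ continuousOn_scalingProfile p q hφc huc hPc hQc hRc hSc
    (fun _ ↦ sq_nonneg _) t
  have hΘ' := continuousOn_scalingProfileDeriv p q hφc huc hPc hQc hRc hSc (fun _ ↦ sq_nonneg _)
  have hE : ∀ t, ∫ x in (extChartAt (𝓡 n) x₀).symm ''
      Metric.closedBall (extChartAt (𝓡 n) x₀ x₀) φ.rOut,
      verticalEnergyDensity cov p q ((fun x ↦ 1 + t * φ x) • σ) x ∂(riemannianVolume n M) = _ :=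
    fun t ↦ (setIntegral_riemannianVolume x₀ hK hKT ((hΘ t).congr fun y hy ↦ by
      rw [Function.comp_apply, hdens t y hy, φ.apply_extChartAt_symm hy])).trans
      (setIntegral_congr_fun hK.measurableSet fun y hy ↦ by
        rw [hdens t y (hKT hy), φ.apply_extChartAt_symm (hKT hy)])
  have hder := hasDerivAt_setIntegral_of_continuousOn (μ := volume) hK
    (fun t ↦ (hDc.fun_mul (hΘ t)).mono hKT)
    (fun t y _ ↦ (hasDerivAt_scalingProfile p q _ (sq_nonneg _) _ _ _ _ t).const_mul
      (volumeDensity x₀ y))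
    (((hDc.comp continuousOn_snd fun z hz ↦ hz.2).mul hΘ').mono (Set.prod_mono le_rfl hKT)) 0
  simp only [verticalEnergyOn, hE] at hvar
  have h := hvar.unique (hder.const_mul (1 / 2))
  exact (mul_eq_zero.1 h.symm).resolve_left (by norm_num)

end Harmonic

/-! ### The integrated identity for harmonic `|σ|²` and its rigidity consequences -/

section Rigidity

variable {n : ℕ} {M : Type*} [TopologicalSpace M] [ChartedSpace (EuclideanSpace ℝ (Fin n)) M]
  [IsManifold (𝓡 n) ∞ M]
  {F : Type*} [NormedAddCommGroup F] [NormedSpace ℝ F] [FiniteDimensional ℝ F]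
  {V : M → Type*} [TopologicalSpace (TotalSpace F V)]
  [∀ x, NormedAddCommGroup (V x)] [∀ x, InnerProductSpace ℝ (V x)] [FiberBundle F V]
  [VectorBundle ℝ F V] [ContMDiffVectorBundle ∞ F V (𝓡 n)]
  [IsContMDiffRiemannianBundle (𝓡 n) ∞ F V]
  [RiemannianBundle (fun x : M ↦ TangentSpace (𝓡 n) x)]
  [IsContMDiffRiemannianBundle (𝓡 n) ∞ (EuclideanSpace ℝ (Fin n))
    (fun x : M ↦ TangentSpace (𝓡 n) x)]

/-- The weighted gradient field `√g ∑ g^{ij} ∂_j f` whose divergence is the Laplacian of `f`. -/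
def densityGrad (x₀ : M) (f : M → ℝ) (i : Fin n) (z : EuclideanSpace ℝ (Fin n)) : ℝ :=
  volumeDensity x₀ z * ∑ j : Fin n, (gramMatrix x₀ z)⁻¹ i j *
    fderiv ℝ (f ∘ (extChartAt (𝓡 n) x₀).symm) z (EuclideanSpace.single j (1 : ℝ))

omit [IsContMDiffRiemannianBundle (𝓡 n) ∞ (EuclideanSpace ℝ (Fin n))
    (fun x : M ↦ TangentSpace (𝓡 n) x)] in
lemma IsHarmonicFunction.sum_fderiv_densityGrad {f : M → ℝ} (hf : IsHarmonicFunction n f) (x₀ : M)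
    {y : EuclideanSpace ℝ (Fin n)} (hy : y ∈ (extChartAt (𝓡 n) x₀).target) :
    ∑ i, fderiv ℝ (densityGrad x₀ f i) y (EuclideanSpace.single i (1 : ℝ)) = 0 :=
  (mul_eq_zero.1 (hf.2 x₀ y hy)).resolve_left (inv_ne_zero (volumeDensity_pos x₀ hy).ne')

lemma contDiffOn_densityGrad (x₀ : M) {f : M → ℝ}
    (hf : ContDiffOn ℝ ∞ (f ∘ (extChartAt (𝓡 n) x₀).symm) (extChartAt (𝓡 n) x₀).target)
    (i : Fin n) : ContDiffOn ℝ ∞ (densityGrad x₀ f i) (extChartAt (𝓡 n) x₀).target :=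
  (contDiffOn_volumeDensity x₀).mul (ContDiffOn.sum fun j _ ↦
    (contDiffOn_gramMatrix_inv x₀ i j).mul
      ((hf.fderiv_of_isOpen (isOpen_extChartAt_target x₀) (by simp)).clm_apply contDiffOn_const))

lemma rpow_neg_eq_mul {a : ℝ} (ha : 0 < a) (p : ℝ) : a ^ (-p) = a ^ (-p - 1) * a := by
  rw [Real.rpow_sub_one ha.ne']
  field_simp

/-- The Euler–Lagrange equation of a `(p,q)`-harmonic section of harmonic squared length, tested
against multiples of the section. -/
lemma IsPQHarmonic.integral_mul_bump_eq_zero [T2Space M] [MeasurableSpace M]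
    [BorelSpace M] {cov : CovariantDerivative (𝓡 n) F V}
    (hsmooth : cov.ContMDiffCovariantDerivative ∞) (hmetric : cov.IsMetricCompatible) {p q : ℝ}
    {σ : Π x : M, V x} (hσ : IsSmoothSection n F σ) (hharm : IsPQHarmonic cov p q σ)
    (hΔ : IsHarmonicFunction n (fun x : M ↦ ‖σ x‖ ^ 2)) (x₀ : M)
    (φ : SmoothBumpFunction (𝓡 n) x₀) {u P Q : EuclideanSpace ℝ (Fin n) → ℝ}
    (hu : u = fun y ↦ ‖σ ((extChartAt (𝓡 n) x₀).symm y)‖ ^ 2)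
    (hP : P = fun y ↦ coordTrace x₀ (fun i j ↦
      inner ℝ (covCoord cov σ x₀ i y) (covCoord cov σ x₀ j y)) y)
    (hQ : Q = fun y ↦ coordTrace x₀ (fun i j ↦
      inner ℝ (covCoord cov σ x₀ i y) (σ ((extChartAt (𝓡 n) x₀).symm y)) *
      inner ℝ (covCoord cov σ x₀ j y) (σ ((extChartAt (𝓡 n) x₀).symm y))) y) :
    ContinuousOn (fun y ↦ volumeDensity x₀ y * (1 + u y) ^ (-p - 1) *
      ((1 + (1 - p) * u y) * P y + p * (2 + q * u y) * Q y)) (extChartAt (𝓡 n) x₀).target ∧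
    ∫ y, (volumeDensity x₀ y * (1 + u y) ^ (-p - 1) *
      ((1 + (1 - p) * u y) * P y + p * (2 + q * u y) * Q y)) * φ.toContDiffBump y = 0 := by
  have hT : IsOpen (extChartAt (𝓡 n) x₀).target := isOpen_extChartAt_target x₀
  have hvar := hharm.setIntegral_scalingProfileDeriv_eq_zero hsmooth hσ x₀ φ
  set B := φ.toContDiffBump
  set T := (extChartAt (𝓡 n) x₀).target
  have hBT : tsupport B ⊆ T := B.tsupport_eq.trans_subset φ.closedBall_subset_target
  have hBc : HasCompactSupport B := B.hasCompactSupport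
  have hus : ContDiffOn ℝ ∞ u T := hu ▸ contDiffOn_normSq_section hσ x₀
  have hu0 : ∀ y, 0 < 1 + u y := fun y ↦ by rw [hu]; positivity
  -- On the chart target, `f i` is half the `i`-th derivative of `u`, by metric compatibility.
  obtain ⟨f, hf⟩ : ∃ f : Fin n → EuclideanSpace ℝ (Fin n) → ℝ, ∀ i y, f i y =
      inner ℝ (covCoord cov σ x₀ i y) (σ ((extChartAt (𝓡 n) x₀).symm y)) := ⟨_, fun _ _ ↦ rfl⟩
  simp only [← hf] at hvar hQ
  have hfc : ∀ i, ContinuousOn (f i) T := fun i ↦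
    ((contDiffOn_inner_of_contMDiffOn (contMDiffOn_covCoord hsmooth hσ x₀ i)
      (contMDiffOn_section_comp_symm hσ x₀)).continuousOn).congr fun y _ ↦ hf i y
  have hPc : ContinuousOn P T := hP ▸ continuousOn_coordTrace (n := n) x₀ (A := fun y i j ↦
    inner ℝ (covCoord cov σ x₀ i y) (covCoord cov σ x₀ j y)) fun i j ↦
    (contDiffOn_inner_of_contMDiffOn (contMDiffOn_covCoord hsmooth hσ x₀ i)
      (contMDiffOn_covCoord hsmooth hσ x₀ j)).continuousOn
  have hQc : ContinuousOn Q T := hQ ▸ continuousOn_coordTrace (n := n) x₀ fun i j ↦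
    (hfc i).fun_mul (hfc j)
  have hDc : ContinuousOn (volumeDensity (n := n) x₀) T :=
    (contDiffOn_volumeDensity x₀).continuousOn
  have huc : ContinuousOn u T := hus.continuousOn
  have hWc : ∀ r : ℝ, ContinuousOn (fun y ↦ (1 + u y) ^ r) T := fun r ↦
    (continuousOn_const.add huc).rpow_const fun y _ ↦ Or.inl (hu0 y).ne'
  have hW1 := hWc (-p - 1)
  have hW2 := hWc (-p)
  refine ⟨by fun_prop, ?_⟩
  set Z := densityGrad (n := n) x₀ (fun x : M ↦ ‖σ x‖ ^ 2) with hZ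
  have hZs : ∀ i, ContDiffOn ℝ 1 (Z i) T := fun i ↦
    (contDiffOn_densityGrad x₀ (f := fun x : M ↦ ‖σ x‖ ^ 2)
      (contDiffOn_normSq_section hσ x₀) i).of_le (by simp)
  have hZf : ∀ i, ∀ y ∈ T, Z i y = volumeDensity x₀ y * ∑ j, (gramMatrix x₀ y)⁻¹ i j *
      (2 * f j y) := fun i y hy ↦ by
    simp only [hZ, densityGrad, fderiv_normSq_section hmetric hσ x₀ hy, ← hf]
  -- This is half the coefficient of `R` in the first variation; since `∑ Z_i ∂_iφ` is `2R` times
  -- the density, `η ∑ Z_i ∂_iφ` is exactly the gradient term.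
  set η : EuclideanSpace ℝ (Fin n) → ℝ := fun y ↦ (1 + u y) ^ (-p) * (1 + q * u y) with hη
  have hηs : ContDiffOn ℝ 1 η T := by
    have h1 : ContDiffOn ℝ ∞ (fun y ↦ (1 + u y) ^ (-p)) T :=
      (contDiffOn_const.add hus).rpow_const_of_ne fun y _ ↦ (hu0 y).ne'
    exact (h1.mul (contDiffOn_const.add (contDiffOn_const.mul hus))).of_le (by simp)
  have hηd : ∀ y ∈ T, ∀ i, fderiv ℝ η y (EuclideanSpace.single i (1 : ℝ)) =
      (q * (1 + u y) ^ (-p) - p * (1 + u y) ^ (-p - 1) * (1 + q * u y)) * (2 * f i y) := by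
    intro y hy i
    have hud : HasFDerivAt u (fderiv ℝ u y) y :=
      ((hus.contDiffAt (hT.mem_nhds hy)).differentiableAt (by simp)).hasFDerivAt
    have hui : fderiv ℝ u y (EuclideanSpace.single i (1 : ℝ)) = 2 * f i y := by
      rw [hf, ← fderiv_normSq_section hmetric hσ x₀ hy, hu]
      rfl
    have h := ((hud.const_add 1).rpow_const (p := -p) (Or.inl (hu0 y).ne')).mul
      ((hud.const_mul q).const_add 1)
    have h' : HasFDerivAt η _ y := h
    rw [h'.fderiv]
    simp only [add_apply, smul_apply, smul_eq_mul, hui]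
    ring
  have hibp := integral_mul_sum_fderiv_of_div_eq_zero (μ := volume) hT
    (fun i : Fin n ↦ EuclideanSpace.single i (1 : ℝ)) hZs
    (fun y hy ↦ hΔ.sum_fderiv_densityGrad x₀ hy) hηs B.contDiff hBc hBT
  have hdBc : ∀ i : Fin n, Continuous (fun y ↦ fderiv ℝ B y (EuclideanSpace.single i (1 : ℝ))) :=
    fun i ↦ ((B.contDiff (n := 1)).continuous_fderiv one_ne_zero).clm_apply continuous_const
  set G : EuclideanSpace ℝ (Fin n) → ℝ := fun y ↦ volumeDensity x₀ y *
    (-2 * p * u y * (1 + u y) ^ (-p - 1) * (P y + q * Q y) +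
      (1 + u y) ^ (-p) * (2 * P y + 4 * q * Q y)) with hG
  have hGc : ContinuousOn G T := by fun_prop
  have hGi : Integrable fun y ↦ G y * B y :=
    integrable_mul_of_tsupport_subset hT hGc B.continuous hBc hBT
  have hZi : Integrable fun y ↦
      η y * ∑ i, Z i y * fderiv ℝ B y (EuclideanSpace.single i (1 : ℝ)) := by
    simp only [Finset.mul_sum, ← mul_assoc]
    exact integrable_finsetSum _ fun i _ ↦ integrable_mul_of_tsupport_subset hT
      (hηs.continuousOn.mul (hZs i).continuousOn) (hdBc i) (hBc.fderiv_apply ℝ _)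
      ((tsupport_fderiv_apply_subset ℝ _).trans hBT)
  have hηZc : ContinuousOn (fun y ↦
      ∑ i, fderiv ℝ η y (EuclideanSpace.single i (1 : ℝ)) * Z i y) T :=
    continuousOn_finsetSum _ fun i _ ↦
      ((hηs.continuousOn_fderiv_of_isOpen hT le_rfl).clm_apply continuousOn_const).mul
        (hZs i).continuousOn
  have hηZi : Integrable fun y ↦
      (∑ i, fderiv ℝ η y (EuclideanSpace.single i (1 : ℝ)) * Z i y) * B y :=
    integrable_mul_of_tsupport_subset hT hηZc B.continuous hBc hBT
  -- The first variation, split into the part `G` multiplying `φ` and the part containing `∇φ`. Both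
  -- vanish off the closed ball, so the integral can be taken over the whole space.
  have hsum : ∫ y, (G y * B y +
      η y * ∑ i, Z i y * fderiv ℝ B y (EuclideanSpace.single i (1 : ℝ))) = 0 := by
    rw [← hvar, ← setIntegral_eq_integral_of_forall_compl_eq_zero
      (s := Metric.closedBall (extChartAt (𝓡 n) x₀ x₀) φ.rOut)]
    · refine setIntegral_congr_fun measurableSet_closedBall fun y hy ↦ ?_
      have hyT := φ.closedBall_subset_target hy
      have hR : ∑ i, Z i y * fderiv ℝ B y (EuclideanSpace.single i (1 : ℝ)) =
          2 * volumeDensity x₀ y * coordTrace x₀ (fun i j ↦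
            fderiv ℝ B y (EuclideanSpace.single i (1 : ℝ)) * f j y) y := by
        rw [coordTrace, Finset.mul_sum]
        refine Finset.sum_congr rfl fun i _ ↦ ?_
        rw [hZf i y hyT, Finset.mul_sum, Finset.mul_sum, Finset.sum_mul]
        exact Finset.sum_congr rfl fun j _ ↦ by ring
      simp only [hR, scalingProfileDeriv_zero, hG, hη, hP, hQ, hu]
      ring
    · intro y hy
      rw [← B.tsupport_eq] at hy
      have h1 : B y = 0 := image_eq_zero_of_notMem_tsupport hy
      have h2 : fderiv ℝ B y = 0 := image_eq_zero_of_notMem_tsupport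
        fun h ↦ hy (tsupport_fderiv_subset ℝ h)
      rw [h1, mul_zero, zero_add, Finset.sum_eq_zero fun i _ ↦ ?_, mul_zero]
      rw [h2, zero_apply, mul_zero]
  rw [integral_add hGi hZi, hibp, ← sub_eq_add_neg, ← integral_sub hGi hηZi] at hsum
  -- After integration by parts and removal of the factor `(1 + u)^(-p-1)`, half the coefficient of
  -- `Q` is `-pqu + 2q(1 + u) - 2q(1 + u) + 2p(1 + qu) = p(2 + qu)`.
  have hfin : ∀ y, (volumeDensity x₀ y * (1 + u y) ^ (-p - 1) *
      ((1 + (1 - p) * u y) * P y + p * (2 + q * u y) * Q y)) * B y = (1 / 2) * (G y * B y -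
      (∑ i, fderiv ℝ η y (EuclideanSpace.single i (1 : ℝ)) * Z i y) * B y) := by
    intro y
    by_cases hy : y ∈ T
    · have hQ' : ∑ i, fderiv ℝ η y (EuclideanSpace.single i (1 : ℝ)) * Z i y =
          4 * volumeDensity x₀ y *
            (q * (1 + u y) ^ (-p) - p * (1 + u y) ^ (-p - 1) * (1 + q * u y)) * Q y := by
        rw [congrFun hQ y]
        simp only [coordTrace]
        rw [Finset.mul_sum]
        refine Finset.sum_congr rfl fun i _ ↦ ?_
        rw [hηd y hy i, hZf i y hy, Finset.mul_sum, Finset.mul_sum, Finset.mul_sum]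
        exact Finset.sum_congr rfl fun j _ ↦ by ring
      rw [hQ', hG]
      simp only
      rw [rpow_neg_eq_mul (hu0 y)]
      ring
    · have : B y = 0 := image_eq_zero_of_notMem_tsupport fun h ↦ hy (hBT h)
      rw [this, mul_zero, mul_zero, mul_zero, sub_zero, mul_zero]
  simp only [hfin, integral_const_mul, hsum, mul_zero]

/-- If the coefficients of the Euler–Lagrange equation are nonnegative, then `∇σ` vanishes where the
coefficient of `|∇σ|²` is positive. -/
lemma IsPQHarmonic.cov_eq_zero [T2Space M] [MeasurableSpace M]
    [BorelSpace M] {cov : CovariantDerivative (𝓡 n) F V}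
    (hsmooth : cov.ContMDiffCovariantDerivative ∞) (hmetric : cov.IsMetricCompatible) {p q : ℝ}
    {σ : Π x : M, V x} (hσ : IsSmoothSection n F σ) (hharm : IsPQHarmonic cov p q σ)
    (hΔ : IsHarmonicFunction n (fun x : M ↦ ‖σ x‖ ^ 2)) (hp : 0 ≤ p)
    (h1 : ∀ x, 0 ≤ 1 + (1 - p) * ‖σ x‖ ^ 2) (h2 : ∀ x, 0 ≤ 2 + q * ‖σ x‖ ^ 2) {x₀ : M}
    (hx₀ : 0 < 1 + (1 - p) * ‖σ x₀‖ ^ 2) : cov σ x₀ = 0 := by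
  obtain ⟨φ⟩ : Nonempty (SmoothBumpFunction (𝓡 n) x₀) := inferInstance
  obtain ⟨hc, hint⟩ := hharm.integral_mul_bump_eq_zero hsmooth hmetric hσ hΔ x₀ φ rfl rfl rfl
  have hT : IsOpen (extChartAt (𝓡 n) x₀).target := isOpen_extChartAt_target x₀
  have hBT : tsupport φ.toContDiffBump ⊆ (extChartAt (𝓡 n) x₀).target :=
    φ.toContDiffBump.tsupport_eq.trans_subset φ.closedBall_subset_target
  have hy₀ : extChartAt (𝓡 n) x₀ x₀ ∈ (extChartAt (𝓡 n) x₀).target := mem_extChartAt_target x₀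
  have hcont := continuous_mul_of_tsupport_subset hT hc φ.toContDiffBump.continuous hBT
  have hP0 : ∀ y ∈ (extChartAt (𝓡 n) x₀).target, 0 ≤ coordTrace x₀ (fun i j ↦
      inner ℝ (covCoord cov σ x₀ i y) (covCoord cov σ x₀ j y)) y := fun y hy ↦
    (verticalEnergyDensity_zero_zero_nonneg cov σ _).trans_eq
      (coordTrace_inner_covCoord cov σ x₀ hy).symm
  by_contra hne
  have hpos : 0 < coordTrace x₀ (fun i j ↦
      inner ℝ (covCoord cov σ x₀ i (extChartAt (𝓡 n) x₀ x₀))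
        (covCoord cov σ x₀ j (extChartAt (𝓡 n) x₀ x₀))) (extChartAt (𝓡 n) x₀ x₀) := by
    refine (hP0 _ hy₀).lt_of_ne' fun h ↦ hne ?_
    rw [coordTrace_inner_covCoord cov σ x₀ hy₀, extChartAt_to_inv] at h
    exact cov_eq_zero_of_verticalEnergyDensity_zero_zero h
  -- A continuous nonnegative integrand that is nonzero at the centre of the chart, where the bump
  -- is positive, would have a positive integral.
  refine (hcont.integral_pos_of_hasCompactSupport_nonneg_nonzero (μ := volume)
    (x := extChartAt (𝓡 n) x₀ x₀) (φ.toContDiffBump.hasCompactSupport.mul_left) ?_ ?_).ne' hint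
  · intro y
    by_cases hy : y ∈ (extChartAt (𝓡 n) x₀).target
    · have hD := (volumeDensity_pos x₀ hy).le
      have hQ0 := coordTrace_mul_self_nonneg x₀ hy fun i ↦
        inner ℝ (covCoord cov σ x₀ i y) (σ ((extChartAt (𝓡 n) x₀).symm y))
      have hW : (0 : ℝ) ≤ (1 + ‖σ ((extChartAt (𝓡 n) x₀).symm y)‖ ^ 2) ^ (-p - 1) := by positivity
      exact mul_nonneg (mul_nonneg (mul_nonneg hD hW) (add_nonneg (mul_nonneg (h1 _) (hP0 y hy))
        (mul_nonneg (mul_nonneg hp (h2 _)) hQ0))) φ.toContDiffBump.nonneg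
    · have : φ.toContDiffBump y = 0 := image_eq_zero_of_notMem_tsupport fun h ↦ hy (hBT h)
      exact (mul_eq_zero_of_right _ this).ge
  · have hD := volumeDensity_pos x₀ hy₀
    have hQ0 := coordTrace_mul_self_nonneg x₀ hy₀ fun i ↦
      inner ℝ (covCoord cov σ x₀ i (extChartAt (𝓡 n) x₀ x₀))
        (σ ((extChartAt (𝓡 n) x₀).symm (extChartAt (𝓡 n) x₀ x₀)))
    have hx₀' : 0 < 1 + (1 - p) *
        ‖σ ((extChartAt (𝓡 n) x₀).symm (extChartAt (𝓡 n) x₀ x₀))‖ ^ 2 := by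
      rwa [extChartAt_to_inv]
    have hW : (0 : ℝ) < (1 + ‖σ ((extChartAt (𝓡 n) x₀).symm (extChartAt (𝓡 n) x₀ x₀))‖ ^ 2) ^
      (-p - 1) := by positivity
    refine (mul_pos (mul_pos (mul_pos hD hW) (add_pos_of_pos_of_nonneg (mul_pos hx₀' hpos)
      (mul_nonneg (mul_nonneg hp (h2 _)) hQ0))) ?_).ne'
    exact φ.toContDiffBump.pos_of_mem_ball (Metric.mem_ball_self φ.rOut_pos)

omit [RiemannianBundle (fun x : M ↦ TangentSpace (𝓡 n) x)]
  [IsContMDiffRiemannianBundle (𝓡 n) ∞ (EuclideanSpace ℝ (Fin n))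
    (fun x : M ↦ TangentSpace (𝓡 n) x)] in
/-- A section which is parallel near `x₀` has locally constant length near `x₀`. -/
lemma eventually_normSq_eq_of_eventually_cov_eq_zero {cov : CovariantDerivative (𝓡 n) F V}
    (hmetric : cov.IsMetricCompatible) {σ : Π x : M, V x} (hσ : IsSmoothSection n F σ) {x₀ : M}
    (h : ∀ᶠ x in nhds x₀, cov σ x = 0) : ∀ᶠ x in nhds x₀, ‖σ x‖ ^ 2 = ‖σ x₀‖ ^ 2 := by
  set ψ := (extChartAt (𝓡 n) x₀).symm with hψ
  set y₀ := extChartAt (𝓡 n) x₀ x₀ with hy₀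
  have hψc : Filter.Tendsto ψ (nhds y₀) (nhds x₀) := by
    have h := (continuousOn_extChartAt_symm (I := 𝓡 n) x₀).continuousAt
      (extChartAt_target_mem_nhds x₀)
    rw [ContinuousAt, extChartAt_to_inv] at h
    exact h
  obtain ⟨r, hr, hball⟩ := Metric.mem_nhds_iff.1
    (Filter.inter_mem (hψc.eventually h) (extChartAt_target_mem_nhds (I := 𝓡 n) x₀))
  have hus := contDiffOn_normSq_section hσ x₀
  -- On a ball, which is connected, `u` has derivative `2⟨∇_i σ, σ⟩ = 0` in every coordinate
  -- direction.
  have hconst : ∀ y ∈ Metric.ball y₀ r, ‖σ (ψ y)‖ ^ 2 = ‖σ (ψ y₀)‖ ^ 2 := fun y hy ↦ by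
    refine Metric.isOpen_ball.is_const_of_fderiv_eq_zero (𝕜 := ℝ) (s := Metric.ball y₀ r)
      (f := fun y ↦ ‖σ (ψ y)‖ ^ 2) (convex_ball y₀ r).isPreconnected
      ((hus.differentiableOn (by simp)).mono fun y hy ↦ (hball hy).2) (fun z hz ↦ ?_) hy
      (Metric.mem_ball_self hr)
    refine ContinuousLinearMap.coe_injective
      ((EuclideanSpace.basisFun (Fin n) ℝ).toBasis.ext fun i ↦ ?_)
    have hd := fderiv_normSq_section hmetric hσ x₀ (hball hz).2 i
    have h0 : covCoord cov σ x₀ i z = 0 := by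
      rw [covCoord, (hball hz).1]
      rfl
    rw [h0, inner_zero_left, mul_zero] at hd
    rw [OrthonormalBasis.coe_toBasis, EuclideanSpace.basisFun_apply]
    exact hd
  filter_upwards [(continuousAt_extChartAt (I := 𝓡 n) x₀).eventually (Metric.ball_mem_nhds y₀ hr),
    extChartAt_source_mem_nhds (I := 𝓡 n) x₀] with x hx hxs
  have := hconst _ hx
  rwa [hψ, (extChartAt (𝓡 n) x₀).left_inv hxs, hy₀, extChartAt_to_inv] at this

end Rigidity

end

/-! ### Signs of the coefficients under the two alternatives -/

theorem theorem4p5 {n : ℕ} {M : Type*} [TopologicalSpace M] [T2Space M] [SigmaCompactSpace M]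
    [MeasurableSpace M] [BorelSpace M]
    [ChartedSpace (EuclideanSpace ℝ (Fin n)) M] [IsManifold (𝓡 n) ∞ M]
    [RiemannianBundle (fun x : M ↦ TangentSpace (𝓡 n) x)]
    [IsContMDiffRiemannianBundle (𝓡 n) ∞ (EuclideanSpace ℝ (Fin n))
      (fun x : M ↦ TangentSpace (𝓡 n) x)]
    {F : Type*} [NormedAddCommGroup F] [NormedSpace ℝ F] [FiniteDimensional ℝ F]
    {V : M → Type*} [TopologicalSpace (TotalSpace F V)]
    [∀ x, NormedAddCommGroup (V x)] [∀ x, InnerProductSpace ℝ (V x)]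
    [FiberBundle F V] [VectorBundle ℝ F V] [ContMDiffVectorBundle ∞ F V (𝓡 n)]
    [IsContMDiffRiemannianBundle (𝓡 n) ∞ F V]
    (cov : CovariantDerivative (𝓡 n) F V) (hsmooth : cov.ContMDiffCovariantDerivative ∞)
    (hmetric : cov.IsMetricCompatible)
    (σ : Π x : M, V x) (p q ν : ℝ) (hpq : (p, q) ∈ regionG₁ ν)
    (hσ : (1 < ν ∧ IsQRiemannian n F (ν * (1 - p)) σ) ∨
      (ν = 1 ∧ IsStrictlyQRiemannian n F (1 - p) σ ∧ ConnectedSpace M))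
    (hharm : IsHarmonicFunction n (fun x : M ↦ ‖σ x‖ ^ 2)) :
    IsPQHarmonic cov p q σ ↔ IsParallelSection cov σ := by
  obtain ⟨hp, hq⟩ : 1 < p ∧ 2 * ν * (1 - p) ≤ q := hpq
  refine ⟨fun hpqharm ↦ ?_, fun h ↦ h.isPQHarmonic hsmooth hmetric (by linarith) q⟩
  have hq' : (∀ x, -1 ≤ ν * (1 - p) * ‖σ x‖ ^ 2) → ∀ x, 0 ≤ 2 + q * ‖σ x‖ ^ 2 := fun h x ↦ by
    -- `q u ≥ 2ν(1-p)u ≥ -2`, which is where the bound defining the region is used.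
    have := mul_le_mul_of_nonneg_right hq (sq_nonneg ‖σ x‖)
    linarith [h x]
  rcases hσ with ⟨hν, hσs, hR⟩ | ⟨rfl, ⟨⟨hσs, hR⟩, x₁, hx₁⟩, hconn⟩
  · have hpos : ∀ x, 0 < 1 + (1 - p) * ‖σ x‖ ^ 2 := fun x ↦ by
      by_contra! hle
      have hneg : (1 - p) * ‖σ x‖ ^ 2 < 0 := by linarith
      -- If `(1-p)u ≤ -1`, multiplying by `ν > 1` gives `ν(1-p)u < -1`, a contradiction.
      nlinarith [hR x]
    exact fun x ↦ hpqharm.cov_eq_zero hsmooth hmetric hσs hharm (by linarith)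
      (fun x ↦ (hpos x).le) (hq' hR) (hpos x)
  · have h0 : ∀ x, 0 ≤ 1 + (1 - p) * ‖σ x‖ ^ 2 := fun x ↦ by linarith [hR x]
    have hcov : ∀ x, 0 < 1 + (1 - p) * ‖σ x‖ ^ 2 → cov σ x = 0 := fun x hx ↦
      hpqharm.cov_eq_zero hsmooth hmetric hσs hharm (by linarith) h0
        (hq' fun x ↦ by linarith [hR x]) hx
    have hcont : Continuous fun x ↦ ‖σ x‖ ^ 2 := hharm.1.continuous
    -- The positivity of `1 + (1-p)u` at `x₁` persists on this level set and, by continuity, near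
    -- each of its points; there `σ` is parallel, so `u` is locally constant and the level set is
    -- open.
    have hlevel : {x | ‖σ x‖ ^ 2 = ‖σ x₁‖ ^ 2} = Set.univ := by
      refine IsClopen.eq_univ ⟨isClosed_eq hcont continuous_const, ?_⟩ ⟨x₁, rfl⟩
      refine isOpen_iff_mem_nhds.2 fun x (hx : ‖σ x‖ ^ 2 = ‖σ x₁‖ ^ 2) ↦ ?_
      have hxpos : 0 < 1 + (1 - p) * ‖σ x‖ ^ 2 := by rw [hx]; linarith
      have hev : ∀ᶠ z in nhds x, cov σ z = 0 :=
        ((continuous_const.add (continuous_const.mul hcont)).continuousAt.eventually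
          (lt_mem_nhds hxpos)).mono hcov
      filter_upwards [eventually_normSq_eq_of_eventually_cov_eq_zero hmetric hσs hev] with z hz
      exact hz.trans hx
    intro x
    have hx : ‖σ x‖ ^ 2 = ‖σ x₁‖ ^ 2 := Set.eq_univ_iff_forall.1 hlevel x
    exact hcov x (by rw [hx]; linarith)
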